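/- Let $n\ge 2$ and let $\Omega\subset\mathbb R^n$ be a bounded domain. Let $\alpha,A,\varepsilon>0$ be constants and let $K$ be a Borel set. Then there is a constant $C=C(\alpha,A,K,\varepsilon)>0$ (depending also on $n$ and $\Omega$) with the following property. Let $D$ be an open set with $K\subset\subset D\subset\subset\Omega$ (that is, $\overline K$ is a compact subset of $D$ and $\overline D$ is a compact subset of $\Omega$), and let $\mu$ be a non-negative Radon measure on $\Omega$ such that $$\mu(B(z,r))\le A\,r^{\,n-2+\alpha}\qquad\text{for all balls } B(z,r)\subset D .$$ Let $u:\Omega\to[-\infty,\infty)$ be subharmonic (and not identically $-\infty$), and let $\delta>0$ be such that $B(x,\delta)\subset D$ for every $x\in K$. Write $$\tilde u_\delta(x)=\frac1{c_n\delta^n}\int_{\{|y|<\delta\}}u(x+y)\,dy ,$$ where $c_n$ is the volume of the unit ball of $\mathbb R^n$, and let $\Delta u$ be the distributional Laplacian of $u$, a non-negative Radon measure on $\Omega$. Then $\tilde u_\delta$ is finite and $\tilde u_\delta\ge u$ on $K$, and $$\int_K(\tilde u_\delta-u)\,d\mu\;\le\; C\,\Big(\int_{\overline D}\Delta u\Big)\,\delta^{\frac{\alpha-\varepsilon}{1+\alpha}}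 .$$ -/

import Mathlib

open MeasureTheory Set
open scoped ENNReal

noncomputable section

/-- Integral of an extended-real-valued function, as the integral of the positive part minus the
integral of the negative part. It is only used for functions that are bounded above on a set of
finite measure, so that the positive part has a finite integral. -/
def extIntegral {X : Type*} [MeasurableSpace X] (m : Measure X) (f : X → EReal) : EReal :=
  ((∫⁻ y, (f y).toENNReal ∂m : ℝ≥0∞) : EReal) - ((∫⁻ y, (-f y).toENNReal ∂m : ℝ≥0∞) : EReal)

/-- The ball average `(c_n δ^n)⁻¹ ∫_{|y| < δ} u (x + y) dy`, where `c_n` is the volume of the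
unit ball. -/
def ballAverage {n : ℕ} (u : EuclideanSpace ℝ (Fin n) → EReal) (δ : ℝ)
    (x : EuclideanSpace ℝ (Fin n)) : EReal :=
  ((((volume (Metric.ball (0 : EuclideanSpace ℝ (Fin n)) 1)).toReal * δ ^ n)⁻¹ : ℝ) : EReal) *
    extIntegral (volume.restrict (Metric.ball (0 : EuclideanSpace ℝ (Fin n)) δ))
      (fun y => u (x + y))

/-- `u` is subharmonic on the domain `Ω`: it is upper semicontinuous with values in `[-∞, ∞)`,
is not identically `-∞`, and lies below its average over every closed ball contained in `Ω`.
The values of `u` off `Ω` play no role. -/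
structure IsSubharmonicOn {n : ℕ} (u : EuclideanSpace ℝ (Fin n) → EReal)
    (Ω : Set (EuclideanSpace ℝ (Fin n))) : Prop where
  usc : UpperSemicontinuousOn u Ω
  lt_top : ∀ x ∈ Ω, u x < ⊤
  exists_ne_bot : ∃ x ∈ Ω, u x ≠ ⊥
  le_average : ∀ x ∈ Ω, ∀ r : ℝ, 0 < r → Metric.closedBall x r ⊆ Ω → u x ≤ ballAverage u r x

/-- `ν` is a Radon measure on the open set `Ω` (extended by any values outside `Ω`): a Borel
measure that is finite on the compact subsets of `Ω`. -/
def IsRadonOn {n : ℕ} (ν : Measure (EuclideanSpace ℝ (Fin n)))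
    (Ω : Set (EuclideanSpace ℝ (Fin n))) : Prop :=
  ∀ L : Set (EuclideanSpace ℝ (Fin n)), IsCompact L → L ⊆ Ω → ν L < ∞

/-- The Radon measure `ν` on `Ω` is the Laplacian of `u` in the sense of distributions:
`∫ φ dν = ∫ u Δφ dx` for all test functions `φ` on `Ω`. The requirement `ν Ωᶜ = 0` makes `ν`
unique as a measure on the whole space. -/
structure IsLaplacianMeasure {n : ℕ} (u : EuclideanSpace ℝ (Fin n) → EReal)
    (Ω : Set (EuclideanSpace ℝ (Fin n))) (ν : Measure (EuclideanSpace ℝ (Fin n))) : Prop where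
  radon : IsRadonOn ν Ω
  compl_eq_zero : ν Ωᶜ = 0
  integral_eq : ∀ φ : EuclideanSpace ℝ (Fin n) → ℝ, ContDiff ℝ (⊤ : ℕ∞) φ → HasCompactSupport φ →
    tsupport φ ⊆ Ω →
      ∫ x, φ x ∂ν = ∫ x in Ω, (u x).toReal * Laplacian.laplacian φ x

open scoped Classical in
/-- The Laplacian `Δu` on `Ω` as a measure: the measure that represents the distributional
Laplacian of `u` on `Ω` (and `0` if the distributional Laplacian is not a measure, which does not
occur for subharmonic `u`). -/
def laplacianMeasure {n : ℕ} (u : EuclideanSpace ℝ (Fin n) → EReal)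
    (Ω : Set (EuclideanSpace ℝ (Fin n))) : Measure (EuclideanSpace ℝ (Fin n)) :=
  if h : ∃ ν, IsLaplacianMeasure u Ω ν then h.choose else 0

end

/-! The defect of the mean value inequality is controlled by a truncated Newtonian kernel. Put `m =
n/2` and let `F' (s) = min (δ ^ 2) ^ (-m), s ^ (-m)` minus the same expression with `r` in place of
`δ`, with `F = 0` from `δ ^ 2` on. The Laplacian of `F (‖y - x‖ ^ 2)` is `2n δ ^ (-n)` on `B(x,δ)`
minus `2n r ^ (-n)` on `B(x,r)`. Smoothing `F` and testing `Δu` against it bounds the difference of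
the two ball averages, times `2n c_n`, by `∫ radialKernel δ x y dΔu(y)`, where the kernel is `∫ t ^
(-n/2) dt` over `‖y - x‖ ^ 2 < t ≤ δ ^ 2` (`IsLaplacianMeasure.ofReal_average_sub_le`). Upper
semicontinuity lets `r` tend to zero and replaces the small average by `u x`
(`IsSubharmonicOn.ballAverage_sub_le`).

Integrating over `K` against `μ` and applying Tonelli, the layer at height `t` contributes `t ^
(-n/2) μ(K ∩ B(y,√t))`, at most a constant times `t ^ (α/2 - 1)`, which integrates to a multiple of
`δ ^ α` uniformly in `y` (`lintegral_lintegral_radialKernel_le`). The exponent `α` exceeds `(α -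
ε)/(1 + α)`, and `δ` is bounded in terms of `Ω`, so the stated power follows.

The distributional Laplacian must also be shown to be a measure. Second difference quotients of ball
means give its positivity on test functions (`IsSubharmonicOn.integral_laplacian_nonneg`), and
extension to a positive functional on `C_c(Ω)` followed by Riesz representation gives the measure.
-/

/-! ### Extended integrals. -/

theorem extIntegral_of_lintegral_neg_ne_top {X : Type*} [MeasurableSpace X] {m : Measure X}
    {f : X → EReal} (hf : AEMeasurable f m) (hpos : ∫⁻ y, (f y).toENNReal ∂m ≠ ⊤)
    (hneg : ∫⁻ y, (-f y).toENNReal ∂m ≠ ⊤) :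
    (∀ᵐ y ∂m, f y ≠ ⊥) ∧ Integrable (fun y => (f y).toReal) m ∧
      extIntegral m f = ((∫ y, (f y).toReal ∂m : ℝ) : EReal) := by
  have h1 : ∀ᵐ y ∂m, (f y).toENNReal < ⊤ :=
    ae_lt_top' (measurable_ereal_toENNReal.comp_aemeasurable hf) hpos
  have h2 : ∀ᵐ y ∂m, (-f y).toENNReal < ⊤ :=
    ae_lt_top' (measurable_ereal_toENNReal.comp_aemeasurable hf.neg) hneg
  have e1 : ∀ᵐ y ∂m, (f y).toENNReal = ENNReal.ofReal (f y).toReal := by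
    filter_upwards [h1] with y hy
    exact EReal.toENNReal_of_ne_top (fun h => by simp [h] at hy)
  have e2 : ∀ᵐ y ∂m, (-f y).toENNReal = ENNReal.ofReal (-(f y).toReal) := by
    filter_upwards [h2] with y hy
    rw [EReal.toENNReal_of_ne_top (fun h => by simp [h] at hy), EReal.toReal_neg_eq]
  have hint : Integrable (fun y => (f y).toReal) m := by
    refine ⟨(measurable_ereal_toReal.comp_aemeasurable hf).aestronglyMeasurable, ?_⟩
    have : ∀ᵐ y ∂m, ‖(f y).toReal‖ₑ ≤ (f y).toENNReal + (-f y).toENNReal := by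
      filter_upwards [e1, e2] with y h1 h2
      rw [h1, h2, ← ofReal_norm, Real.norm_eq_abs]
      rcases abs_cases (f y).toReal with h | h <;> rw [h.1] <;> simp
    refine lt_of_le_of_lt (lintegral_mono_ae this) ?_
    rw [lintegral_add_left' (show AEMeasurable (fun y => (f y).toENNReal) m from
      measurable_ereal_toENNReal.comp_aemeasurable hf)]
    exact ENNReal.add_lt_top.2 ⟨hpos.lt_top, hneg.lt_top⟩
  refine ⟨?_, hint, ?_⟩
  · filter_upwards [h2] with y hy h
    simp [h] at hy
  · rw [integral_eq_lintegral_pos_part_sub_lintegral_neg_part hint, extIntegral,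
      ← lintegral_congr_ae e1, ← lintegral_congr_ae e2, EReal.coe_sub,
      EReal.coe_ennreal_toReal hpos, EReal.coe_ennreal_toReal hneg]

theorem extIntegral_of_lintegral_neg_eq_top {X : Type*} [MeasurableSpace X] {m : Measure X}
    {f : X → EReal} (hpos : ∫⁻ y, (f y).toENNReal ∂m ≠ ⊤)
    (hneg : ∫⁻ y, (-f y).toENNReal ∂m = ⊤) : extIntegral m f = ⊥ := by
  rw [extIntegral, hneg]
  lift (∫⁻ y, (f y).toENNReal ∂m) to NNReal using hpos with a
  simp

/-- The real factor in front of the integral in `ballAverage`. -/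
noncomputable def ballNormalizer (n : ℕ) (δ : ℝ) : ℝ :=
  ((volume (Metric.ball (0 : EuclideanSpace ℝ (Fin n)) 1)).toReal * δ ^ n)⁻¹

/-! ### Local integrability and ball averages of subharmonic functions. -/

section

variable {n : ℕ}

local notation "𝔼" => EuclideanSpace ℝ (Fin n)

theorem extIntegral_ball_add (u : 𝔼 → EReal) (δ : ℝ) (x : 𝔼) :
    extIntegral (volume.restrict (Metric.ball 0 δ)) (fun y => u (x + y)) =
      extIntegral (volume.restrict (Metric.ball x δ)) u := by
  have key : ∀ g : 𝔼 → ℝ≥0∞, ∫⁻ y in Metric.ball 0 δ, g (x + y) = ∫⁻ y in Metric.ball x δ, g y := by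
    intro g
    have := (measurePreserving_add_left volume x).setLIntegral_comp_preimage_emb
      (MeasurableEquiv.addLeft x).measurableEmbedding g (Metric.ball x δ)
    rw [← this]
    congr 2
    ext y
    simp
  simp only [extIntegral, key fun y => (u y).toENNReal, key fun y => (-u y).toENNReal]

/-- With the value `⊤` off `Ω`, every strict sublevel set lies in `Ω` and is open there by
semicontinuity, hence open. -/
theorem IsSubharmonicOn.measurable_piecewise {u : 𝔼 → EReal} {Ω : Set 𝔼}
    (hu : IsSubharmonicOn u Ω) (hΩ : IsOpen Ω) [DecidablePred (· ∈ Ω)] :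
    Measurable (Ω.piecewise u fun _ => ⊤) := by
  have husc := hu.usc
  rw [upperSemicontinuousOn_iff] at husc
  refine measurable_of_Iio fun a => IsOpen.measurableSet (isOpen_iff_mem_nhds.2 fun x hx => ?_)
  by_cases hxΩ : x ∈ Ω
  · have hxa : u x < a := by simpa [hxΩ] using hx
    have := husc x hxΩ a hxa
    rw [hΩ.nhdsWithin_eq hxΩ] at this
    filter_upwards [this, hΩ.mem_nhds hxΩ] with y hy hyΩ
    simpa [hyΩ] using hy
  · simp [hxΩ] at hx

theorem IsSubharmonicOn.aemeasurable {u : 𝔼 → EReal} {Ω : Set 𝔼}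
    (hu : IsSubharmonicOn u Ω) (hΩ : IsOpen Ω) {s : Set 𝔼} (hs : MeasurableSet s) (hsΩ : s ⊆ Ω) :
    AEMeasurable u (volume.restrict s) := by
  classical
  refine ⟨_, hu.measurable_piecewise hΩ, ?_⟩
  filter_upwards [ae_restrict_mem hs] with y hy
  simp [hsΩ hy]

/-- An upper semicontinuous function attains its maximum on the compact closed ball, and this
maximum is below `⊤`. -/
theorem IsSubharmonicOn.lintegral_toENNReal_ne_top {u : 𝔼 → EReal} {Ω : Set 𝔼}
    (hu : IsSubharmonicOn u Ω) {x : 𝔼} {r : ℝ} (hr : 0 < r)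
    (hx : Metric.closedBall x r ⊆ Ω) :
    ∫⁻ y in Metric.ball x r, (u y).toENNReal ≠ ⊤ := by
  obtain ⟨a, ha, hmax⟩ := (hu.usc.mono hx).exists_isMaxOn
    ⟨x, Metric.mem_closedBall_self hr.le⟩ (isCompact_closedBall x r)
  refine ne_top_of_le_ne_top ?_ (setLIntegral_mono' measurableSet_ball
    (g := fun _ => (u a).toENNReal) fun y hy =>
      EReal.toENNReal_le_toENNReal (hmax (Metric.ball_subset_closedBall hy)))
  rw [setLIntegral_const]
  exact ENNReal.mul_ne_top (EReal.toENNReal_ne_top_iff.2 (hu.lt_top a (hx ha)).ne)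
    measure_ball_lt_top.ne

theorem volume_unitBall_toReal_pos : 0 < (volume (Metric.ball (0 : 𝔼) 1)).toReal :=
  ENNReal.toReal_pos (Metric.measure_ball_pos volume _ one_pos).ne' measure_ball_lt_top.ne

theorem ballNormalizer_pos {δ : ℝ} (hδ : 0 < δ) : 0 < ballNormalizer n δ :=
  inv_pos.2 (mul_pos volume_unitBall_toReal_pos (pow_pos hδ n))

theorem ballAverage_eq (u : 𝔼 → EReal) (δ : ℝ) (x : 𝔼) :
    ballAverage u δ x = (ballNormalizer n δ : EReal) *
      extIntegral (volume.restrict (Metric.ball x δ)) u := by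
  rw [ballAverage, extIntegral_ball_add, ballNormalizer]

/-- An infinite negative part would make the average `⊥`, and the mean value inequality would then
force `u x = ⊥`. -/
theorem IsSubharmonicOn.integrableOn_ball_of_ne_bot {u : 𝔼 → EReal} {Ω : Set 𝔼}
    (hu : IsSubharmonicOn u Ω) (hΩ : IsOpen Ω) {x : 𝔼} {r : ℝ} (hr : 0 < r)
    (hx : Metric.closedBall x r ⊆ Ω) (hxu : u x ≠ ⊥) :
    (∀ᵐ y ∂volume.restrict (Metric.ball x r), u y ≠ ⊥) ∧
      IntegrableOn (fun y => (u y).toReal) (Metric.ball x r) := by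
  have hneg : ∫⁻ y in Metric.ball x r, (-u y).toENNReal ≠ ⊤ := by
    intro h
    have := hu.le_average x (hx (Metric.mem_closedBall_self hr.le)) r hr hx
    rw [ballAverage_eq, extIntegral_of_lintegral_neg_eq_top (hu.lintegral_toENNReal_ne_top hr hx) h,
      EReal.coe_mul_bot_of_pos (ballNormalizer_pos hr), le_bot_iff] at this
    exact hxu this
  have := extIntegral_of_lintegral_neg_ne_top
    (hu.aemeasurable hΩ measurableSet_ball (Metric.ball_subset_closedBall.trans hx))
    (hu.lintegral_toENNReal_ne_top hr hx) hneg
  exact ⟨this.1, this.2.1⟩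

/-- Connectedness argument. The set `S` of good points is open. If `z ∈ Ω` is not good, then `u = ⊥`
on a whole ball about `z`, since a nearby point of finite value would be the centre of a good ball
containing `z`. A good ball meeting that ball would do so in positive volume, although `u ≠ ⊥`
almost everywhere on it. So `Ω \ S` is open too, and `S` is nonempty. -/
theorem IsSubharmonicOn.exists_ball {u : 𝔼 → EReal} {Ω : Set 𝔼}
    (hu : IsSubharmonicOn u Ω) (hΩ : IsOpen Ω) (hΩc : IsConnected Ω) {x : 𝔼} (hx : x ∈ Ω) :
    ∃ y r, 0 < r ∧ Metric.closedBall y r ⊆ Ω ∧ u y ≠ ⊥ ∧ x ∈ Metric.ball y r := by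
  set S : Set 𝔼 := {x | ∃ y r, 0 < r ∧ Metric.closedBall y r ⊆ Ω ∧ u y ≠ ⊥ ∧ x ∈ Metric.ball y r}
    with hS
  have hSo : IsOpen S := by
    refine isOpen_iff_mem_nhds.2 ?_
    rintro z ⟨y, r, h1, h2, h3, h4⟩
    filter_upwards [Metric.isOpen_ball.mem_nhds h4] with w hw
    exact ⟨y, r, h1, h2, h3, hw⟩
  by_contra hcon
  have hTo : IsOpen (Ω \ S) := by
    refine isOpen_iff_mem_nhds.2 ?_
    rintro z ⟨hz, hzS⟩
    obtain ⟨r, hr, hrΩ⟩ := Metric.nhds_basis_closedBall.mem_iff.1 (hΩ.mem_nhds hz)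
    have hbot : ∀ y ∈ Metric.ball z (r / 2), u y = ⊥ := by
      intro y hy
      by_contra hne
      refine hzS ⟨y, r / 2, by positivity, ?_, hne, Metric.mem_ball_comm.1 hy⟩
      refine (Metric.closedBall_subset_closedBall' ?_).trans hrΩ
      rw [Metric.mem_ball] at hy
      linarith
    filter_upwards [Metric.ball_mem_nhds z (half_pos hr)] with w hw
    refine ⟨hrΩ (Metric.ball_subset_closedBall (Metric.ball_subset_ball (by linarith) hw)), ?_⟩
    rintro ⟨y, s, hs, hsΩ, hne, hwy⟩
    have h1 := (hu.integrableOn_ball_of_ne_bot hΩ hs hsΩ hne).1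
    rw [ae_restrict_iff' measurableSet_ball] at h1
    have h2 : volume (Metric.ball y s ∩ Metric.ball z (r / 2)) = 0 := by
      refine measure_mono_null ?_ h1
      rintro p ⟨hp1, hp2⟩
      simp only [mem_compl_iff, mem_ofPred_eq]
      exact fun h => h hp1 (hbot p hp2)
    exact ((Metric.isOpen_ball.inter Metric.isOpen_ball).measure_pos volume ⟨w, hwy, hw⟩).ne' h2
  obtain ⟨x0, hx0, hne⟩ := hu.exists_ne_bot
  obtain ⟨r, hr, hrΩ⟩ := Metric.nhds_basis_closedBall.mem_iff.1 (hΩ.mem_nhds hx0)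
  obtain ⟨w, -, hw1, hw2⟩ := hΩc.isPreconnected S (Ω \ S) hSo hTo
    (fun y hy => by by_cases h : y ∈ S <;> simp [h, hy])
    ⟨x0, hx0, x0, r, hr, hrΩ, hne, Metric.mem_ball_self hr⟩ ⟨x, hx, hx, hcon⟩
  exact hw2.2 hw1

theorem IsSubharmonicOn.locallyIntegrableOn {u : 𝔼 → EReal} {Ω : Set 𝔼}
    (hu : IsSubharmonicOn u Ω) (hΩ : IsOpen Ω) (hΩc : IsConnected Ω) :
    LocallyIntegrableOn (fun y => (u y).toReal) Ω := by
  intro x hx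
  obtain ⟨y, r, hr, hrΩ, hne, hxy⟩ := hu.exists_ball hΩ hΩc hx
  exact ⟨_, mem_nhdsWithin_of_mem_nhds (Metric.isOpen_ball.mem_nhds hxy),
    (hu.integrableOn_ball_of_ne_bot hΩ hr hrΩ hne).2⟩

theorem IsSubharmonicOn.ae_ne_bot {u : 𝔼 → EReal} {Ω : Set 𝔼}
    (hu : IsSubharmonicOn u Ω) (hΩ : IsOpen Ω) (hΩc : IsConnected Ω) :
    ∀ᵐ y, y ∈ Ω → u y ≠ ⊥ := by
  have : volume {y | y ∈ Ω ∧ u y = ⊥} = 0 := by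
    refine measure_null_of_locally_null _ fun x hx => ?_
    obtain ⟨y, r, hr, hrΩ, hne, hxy⟩ := hu.exists_ball hΩ hΩc hx.1
    have h1 := (hu.integrableOn_ball_of_ne_bot hΩ hr hrΩ hne).1
    rw [ae_restrict_iff' measurableSet_ball] at h1
    refine ⟨_, inter_mem_nhdsWithin _ (Metric.isOpen_ball.mem_nhds hxy), measure_mono_null ?_ h1⟩
    rintro p ⟨hp1, hp2⟩
    simp only [mem_compl_iff, mem_ofPred_eq]
    exact fun h => h hp2 hp1.2
  rw [ae_iff]
  simpa using this

theorem IsSubharmonicOn.ballAverage_eq_coe {u : 𝔼 → EReal} {Ω : Set 𝔼}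
    (hu : IsSubharmonicOn u Ω) (hΩ : IsOpen Ω) (hΩc : IsConnected Ω) {x : 𝔼} {r : ℝ} (hr : 0 < r)
    (hx : Metric.closedBall x r ⊆ Ω) :
    ballAverage u r x =
      ((ballNormalizer n r * ∫ y in Metric.ball x r, (u y).toReal : ℝ) : EReal) := by
  have hsub := Metric.ball_subset_closedBall.trans hx
  have hint : IntegrableOn (fun y => (u y).toReal) (Metric.ball x r) :=
    ((hu.locallyIntegrableOn hΩ hΩc).integrableOn_compact_subset hx
      (isCompact_closedBall x r)).mono_set Metric.ball_subset_closedBall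
  have hneg : ∫⁻ y in Metric.ball x r, (-u y).toENNReal ≠ ⊤ := by
    have e : ∀ᵐ y ∂volume.restrict (Metric.ball x r),
        (-u y).toENNReal = ENNReal.ofReal (-(u y).toReal) := by
      rw [ae_restrict_iff' measurableSet_ball]
      filter_upwards [hu.ae_ne_bot hΩ hΩc] with y hy hyb
      rw [EReal.toENNReal_of_ne_top, EReal.toReal_neg_eq]
      simpa using hy (hsub hyb)
    rw [lintegral_congr_ae e]
    exact hint.neg.lintegral_lt_top.ne
  rw [ballAverage_eq, (extIntegral_of_lintegral_neg_ne_top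
    (hu.aemeasurable hΩ measurableSet_ball hsub) (hu.lintegral_toENNReal_ne_top hr hx) hneg).2.2,
    EReal.coe_mul]

theorem ballNormalizer_eq {r : ℝ} (hr : 0 < r) (x : 𝔼) :
    ballNormalizer n r = (volume.real (Metric.ball x r))⁻¹ := by
  rw [ballNormalizer, measureReal_def, Measure.addHaar_ball_of_pos volume x hr,
    ENNReal.toReal_mul, ENNReal.toReal_ofReal (by positivity), finrank_euclideanSpace,
    Fintype.card_fin, mul_comm]

/-- The ball averages of a subharmonic function are eventually below every real upper bound of
its value at the centre. -/
theorem IsSubharmonicOn.exists_average_le {u : 𝔼 → EReal} {Ω : Set 𝔼}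
    (hu : IsSubharmonicOn u Ω) (hΩ : IsOpen Ω) (hΩc : IsConnected Ω) {x : 𝔼} (hx : x ∈ Ω) {a : ℝ}
    (ha : u x < a) : ∃ ρ > 0, ∀ r, 0 < r → r < ρ →
      ballNormalizer n r * ∫ y in Metric.ball x r, (u y).toReal ≤ a := by
  have husc := hu.usc
  rw [upperSemicontinuousOn_iff] at husc
  have h1 := husc x hx a ha
  rw [hΩ.nhdsWithin_eq hx] at h1
  obtain ⟨ρ, hρ, hsub⟩ := Metric.nhds_basis_closedBall.mem_iff.1
    (Filter.inter_mem h1 (hΩ.mem_nhds hx))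
  refine ⟨ρ, hρ, fun r hr hrρ => ?_⟩
  have hsubr : Metric.ball x r ⊆ Metric.closedBall x ρ :=
    (Metric.ball_subset_ball hrρ.le).trans Metric.ball_subset_closedBall
  have hint : IntegrableOn (fun y => (u y).toReal) (Metric.ball x r) :=
    ((hu.locallyIntegrableOn hΩ hΩc).integrableOn_compact_subset
      (fun y hy => (hsub hy).2) (isCompact_closedBall x ρ)).mono_set hsubr
  have hle : ∫ y in Metric.ball x r, (u y).toReal ≤ ∫ y in Metric.ball x r, a := by
    refine setIntegral_mono_on_ae hint (integrableOn_const measure_ball_lt_top.ne)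
      measurableSet_ball ?_
    filter_upwards [hu.ae_ne_bot hΩ hΩc] with y hy hyb
    have h := hsub (hsubr hyb)
    have h3 : u y < a := h.1
    have := EReal.toReal_le_toReal h3.le (hy h.2) (EReal.coe_ne_top a)
    simpa using this
  rw [setIntegral_const, smul_eq_mul] at hle
  have hpos := ballNormalizer_pos (n := n) hr
  calc _ ≤ ballNormalizer n r * (volume.real (Metric.ball x r) * a) := by gcongr
    _ = a := by
      rw [ballNormalizer_eq hr x]
      rw [ballNormalizer_eq hr x] at hpos
      field_simp [(inv_pos.1 hpos).ne']

end

/-! ### The Laplacian as a limit of second differences of ball means. -/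

theorem exists_taylor_two {E : Type*} [NormedAddCommGroup E] [NormedSpace ℝ E] {φ : E → ℝ}
    (hφ : ContDiff ℝ 2 φ) (x z : E) {r : ℝ} (hr : 0 < r) :
    ∃ ξ ∈ Ioo 0 r, φ (x + r • z) - φ x - r * fderiv ℝ φ x z =
      r ^ 2 / 2 * fderiv ℝ (fderiv ℝ φ) (x + ξ • z) z z := by
  set g : ℝ → ℝ := fun t => φ (x + t • z) with hg
  have hgc : ContDiff ℝ 2 g := by fun_prop
  have hline : ∀ t : ℝ, HasDerivAt (fun t : ℝ => x + t • z) z t := fun t => by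
    simpa using ((hasDerivAt_id t).smul_const z).const_add x
  have hd1 : ∀ t, HasDerivAt g (fderiv ℝ φ (x + t • z) z) t := fun t =>
    ((hφ.differentiable (by norm_num)).differentiableAt.hasFDerivAt).comp_hasDerivAt t (hline t)
  have hφ1 : ContDiff ℝ 1 (fderiv ℝ φ) := hφ.fderiv_right (by norm_num)
  have hd2 : ∀ t, HasDerivAt (fun t => fderiv ℝ φ (x + t • z) z)
      (fderiv ℝ (fderiv ℝ φ) (x + t • z) z z) t := fun t => by
    have := ((hφ1.differentiable (by norm_num)).differentiableAt.hasFDerivAt).comp_hasDerivAt t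
      (hline t)
    simpa using this.clm_apply (hasDerivAt_const t z)
  have e1 : deriv g = fun t => fderiv ℝ φ (x + t • z) z := funext fun t => (hd1 t).deriv
  have e2 : iteratedDeriv 2 g = fun t => fderiv ℝ (fderiv ℝ φ) (x + t • z) z z := by
    rw [iteratedDeriv_succ, iteratedDeriv_one, e1]
    exact funext fun t => (hd2 t).deriv
  obtain ⟨ξ, hξ, h⟩ := taylor_mean_remainder_lagrange_iteratedDeriv (f := g) (n := 1) hr.ne
    (by exact hgc.contDiffOn)
  rw [uIoo_of_le hr.le] at hξ
  refine ⟨ξ, hξ, ?_⟩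
  rw [taylorWithinEval_succ, taylor_within_zero_eval, iteratedDerivWithin_one,
    (hd1 0).differentiableAt.derivWithin (uniqueDiffOn_uIcc hr.ne 0 left_mem_uIcc),
    (hd1 0).deriv, e2] at h
  simp only [hg, zero_smul, add_zero, smul_eq_mul, Nat.factorial] at h
  norm_num at h
  linarith

theorem exists_bound_fderiv_fderiv {E : Type*} [NormedAddCommGroup E] [NormedSpace ℝ E]
    {φ : E → ℝ} (hφ : ContDiff ℝ 2 φ) (hc : HasCompactSupport φ) :
    ∃ M, ∀ x, ‖fderiv ℝ (fderiv ℝ φ) x‖ ≤ M := by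
  have hD1 : ContDiff ℝ 1 (fderiv ℝ φ) := hφ.fderiv_right (by norm_num)
  have hD2 : Continuous fun x => ‖fderiv ℝ (fderiv ℝ φ) x‖ :=
    (hD1.continuous_fderiv (by norm_num)).norm
  have hsupp : HasCompactSupport fun x => ‖fderiv ℝ (fderiv ℝ φ) x‖ := by
    refine HasCompactSupport.intro hc fun x hx => ?_
    have : x ∉ Function.support (fderiv ℝ (fderiv ℝ φ)) := fun h =>
      hx (tsupport_fderiv_subset ℝ (support_fderiv_subset ℝ h))
    have h0 : fderiv ℝ (fderiv ℝ φ) x = 0 := Function.notMem_support.1 this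
    exact (norm_eq_zero (a := fderiv ℝ (fderiv ℝ φ) x)).2 h0
  obtain ⟨M, hM⟩ := hD2.bounded_above_of_compact_support hsupp
  exact ⟨M, fun x => (le_abs_self _).trans (hM x)⟩

section

variable {n : ℕ}

local notation "𝔼" => EuclideanSpace ℝ (Fin n)

theorem setIntegral_unitBall_comp_isometry (e : 𝔼 ≃ₗᵢ[ℝ] 𝔼) (f : 𝔼 → ℝ) :
    ∫ z in Metric.ball (0 : 𝔼) 1, f (e z) = ∫ z in Metric.ball (0 : 𝔼) 1, f z := by
  have h := e.measurePreserving.setIntegral_preimage_emb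
    e.toHomeomorph.measurableEmbedding f (Metric.ball 0 1)
  rw [← h]
  congr 2
  ext z
  simp

theorem setIntegral_unitBall_mul_of_ne {i j : Fin n} (hij : i ≠ j) :
    ∫ z in Metric.ball (0 : 𝔼) 1, z i * z j = 0 := by
  have h := setIntegral_unitBall_comp_isometry (n := n) (LinearIsometryEquiv.piLpCongrRight 2
    (fun k => if k = i then LinearIsometryEquiv.neg ℝ else LinearIsometryEquiv.refl ℝ ℝ))
    (fun z => z i * z j)
  simp only [LinearIsometryEquiv.piLpCongrRight_apply, if_pos, if_neg hij.symm,
    LinearIsometryEquiv.coe_neg, LinearIsometryEquiv.coe_refl, id, neg_mul, integral_neg] at h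
  linarith

theorem setIntegral_unitBall_sq (i j : Fin n) :
    ∫ z in Metric.ball (0 : 𝔼) 1, z i * z i = ∫ z in Metric.ball (0 : 𝔼) 1, z j * z j := by
  have h := setIntegral_unitBall_comp_isometry (n := n)
    (LinearIsometryEquiv.piLpCongrLeft 2 ℝ ℝ (Equiv.swap i j)) (fun z => z i * z i)
  rw [← h]
  simp [LinearIsometryEquiv.piLpCongrLeft_apply, Equiv.piCongrLeft']

theorem setIntegral_unitBall_sq_pos (i : Fin n) :
    0 < ∫ z in Metric.ball (0 : 𝔼) 1, z i * z i := by
  have hc : Continuous fun z : 𝔼 => z i * z i := by fun_prop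
  rw [setIntegral_pos_iff_support_of_nonneg_ae
    (Filter.Eventually.of_forall fun z => mul_self_nonneg _)
    ((hc.continuousOn.integrableOn_compact (isCompact_closedBall 0 1)).mono_set
      Metric.ball_subset_closedBall)]
  refine (hc.isOpen_support.inter Metric.isOpen_ball).measure_pos volume
    ⟨EuclideanSpace.single i (1 / 2), ?_, ?_⟩
  · simp
  · simp; norm_num

theorem integrableOn_unitBall {f : 𝔼 → ℝ} (hf : Continuous f) :
    IntegrableOn f (Metric.ball 0 1) :=
  (hf.continuousOn.integrableOn_compact (isCompact_closedBall 0 1)).mono_set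
    Metric.ball_subset_closedBall

/-- Reflections of one coordinate kill the mixed second moments of the ball and permutations equate
the pure ones, so only the trace survives; for a Hessian this is the Laplacian. -/
theorem setIntegral_unitBall_bilinear (B : 𝔼 →L[ℝ] 𝔼 →L[ℝ] ℝ) (i₀ : Fin n) :
    ∫ z in Metric.ball (0 : 𝔼) 1, B z z = (∫ z in Metric.ball (0 : 𝔼) 1, z i₀ * z i₀) *
      ∑ i, B (EuclideanSpace.single i 1) (EuclideanSpace.single i 1) := by
  have hexp : ∀ z : 𝔼, B z z = ∑ i, ∑ j, z i * z j *
      B (EuclideanSpace.single i 1) (EuclideanSpace.single j 1) := by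
    intro z
    have hz : z = ∑ i, z i • EuclideanSpace.single i (1 : ℝ) := by
      simpa using ((EuclideanSpace.basisFun (Fin n) ℝ).sum_repr z).symm
    conv_lhs => rw [hz]
    simp only [map_sum, map_smul, sum_apply, smul_apply,
      smul_eq_mul, Finset.mul_sum]
    rw [Finset.sum_comm]
    exact Finset.sum_congr rfl fun i _ => Finset.sum_congr rfl fun j _ => by ring
  have hint : ∀ i j, IntegrableOn (fun z : 𝔼 => z i * z j *
      B (EuclideanSpace.single i 1) (EuclideanSpace.single j 1)) (Metric.ball 0 1) :=
    fun i j => integrableOn_unitBall (by fun_prop)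
  rw [funext hexp, integral_finsetSum _ fun i _ => integrable_finsetSum _ fun j _ => hint i j, Finset.mul_sum]
  refine Finset.sum_congr rfl fun i _ => ?_
  rw [integral_finsetSum _ fun j _ => hint i j, Finset.sum_eq_single i]
  · rw [integral_mul_const, setIntegral_unitBall_sq i i₀]
  · intro j _ hj
    rw [integral_mul_const, setIntegral_unitBall_mul_of_ne hj.symm, zero_mul]
  · simp

theorem setIntegral_unitBall_linear (ℓ : 𝔼 →L[ℝ] ℝ) :
    ∫ z in Metric.ball (0 : 𝔼) 1, ℓ z = 0 := by
  have h := setIntegral_unitBall_comp_isometry (LinearIsometryEquiv.neg ℝ) ℓ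
  simp only [LinearIsometryEquiv.coe_neg, map_neg, integral_neg] at h
  linarith

theorem laplacian_eq_sum_fderiv (φ : 𝔼 → ℝ) (x : 𝔼) :
    Laplacian.laplacian φ x = ∑ i : Fin n, fderiv ℝ (fderiv ℝ φ) x
      (EuclideanSpace.single i 1) (EuclideanSpace.single i 1) := by
  rw [InnerProductSpace.laplacian_eq_iteratedFDeriv_orthonormalBasis φ
    (EuclideanSpace.basisFun (Fin n) ℝ)]
  simp [iteratedFDeriv_two_apply]

theorem setIntegral_ball_eq_unitBall (f : 𝔼 → ℝ) (x : 𝔼) {r : ℝ} (hr : 0 < r) :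
    ∫ y in Metric.ball x r, f y = r ^ n * ∫ z in Metric.ball (0 : 𝔼) 1, f (x + r • z) := by
  have h1 := Measure.setIntegral_comp_smul_of_pos volume (fun y => f (x + y))
    (Metric.ball (0 : 𝔼) 1) hr
  rw [h1, smul_unitBall_of_pos hr, finrank_euclideanSpace, Fintype.card_fin, smul_eq_mul,
    mul_inv_cancel_left₀ (pow_pos hr n).ne']
  have := (measurePreserving_add_left volume x).setIntegral_preimage_emb
      (MeasurableEquiv.addLeft x).measurableEmbedding f (Metric.ball x r)
  rw [← this]
  congr 2
  ext y
  simp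

theorem norm_bilinear_self_le (B : 𝔼 →L[ℝ] 𝔼 →L[ℝ] ℝ) {z : 𝔼} (hz : ‖z‖ ≤ 1) :
    ‖B z z‖ ≤ ‖B‖ :=
  calc ‖B z z‖ ≤ ‖B‖ * ‖z‖ * ‖z‖ := ContinuousLinearMap.le_opNorm₂ _ _ _
    _ ≤ ‖B‖ * 1 * 1 := by gcongr
    _ = ‖B‖ := by ring

instance isFiniteMeasure_restrict_ball (x : 𝔼) (r : ℝ) :
    IsFiniteMeasure (volume.restrict (Metric.ball x r)) :=
  ⟨by simpa using measure_ball_lt_top⟩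

theorem ae_snd_mem_unitBall :
    ∀ᵐ p ∂(volume.prod (volume.restrict (Metric.ball (0 : 𝔼) 1)) : Measure (𝔼 × 𝔼)),
      ‖p.2‖ ≤ 1 := by
  rw [← Measure.restrict_univ (μ := (volume : Measure 𝔼)), Measure.prod_restrict,
    Measure.restrict_univ]
  filter_upwards [ae_restrict_mem (MeasurableSet.univ.prod measurableSet_ball)] with p hp
  have : p.2 ∈ Metric.ball (0 : 𝔼) 1 := hp.2
  rw [mem_ball_zero_iff] at this
  exact this.le

theorem integrable_mul_of_bound {w : 𝔼 → ℝ} (hw : Integrable w) {f : 𝔼 × 𝔼 → ℝ}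
    (hf : Continuous f) {M : ℝ} (hM : ∀ p : 𝔼 × 𝔼, ‖p.2‖ ≤ 1 → ‖f p‖ ≤ M) :
    Integrable (fun p => w p.1 * f p)
      (volume.prod (volume.restrict (Metric.ball (0 : 𝔼) 1))) := by
  refine Integrable.mono' ((hw.abs.mul_const M).comp_fst _)
    ((hw.aestronglyMeasurable.comp_fst).mul hf.aestronglyMeasurable) ?_
  filter_upwards [ae_snd_mem_unitBall] with p hp
  rw [norm_mul, Real.norm_eq_abs]
  exact mul_le_mul_of_nonneg_left (hM p hp) (abs_nonneg _)

/-- The normalized remainder in the first order Taylor expansion of `φ`. -/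
noncomputable def secondQuotient (φ : 𝔼 → ℝ) (r : ℝ) (p : 𝔼 × 𝔼) : ℝ :=
  2 / r ^ 2 * (φ (p.1 + r • p.2) - φ p.1 - r * fderiv ℝ φ p.1 p.2)

theorem continuous_secondQuotient {φ : 𝔼 → ℝ} (hφ : ContDiff ℝ 2 φ) (r : ℝ) :
    Continuous (secondQuotient φ r) := by
  have hD1 : ContDiff ℝ 1 (fderiv ℝ φ) := hφ.fderiv_right (by norm_num)
  have h1 := hφ.continuous
  have h2 : Continuous fun p : 𝔼 × 𝔼 => fderiv ℝ φ p.1 p.2 :=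
    (hD1.continuous.comp continuous_fst).clm_apply continuous_snd
  unfold secondQuotient
  fun_prop

theorem exists_secondQuotient_eq {φ : 𝔼 → ℝ} (hφ : ContDiff ℝ 2 φ) {r : ℝ} (hr : 0 < r)
    (p : 𝔼 × 𝔼) : ∃ ξ ∈ Ioo 0 r,
      secondQuotient φ r p = fderiv ℝ (fderiv ℝ φ) (p.1 + ξ • p.2) p.2 p.2 := by
  obtain ⟨ξ, hξ, h⟩ := exists_taylor_two hφ p.1 p.2 hr
  refine ⟨ξ, hξ, ?_⟩
  simp only [secondQuotient, h]
  field_simp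

theorem tendsto_secondQuotient {φ : 𝔼 → ℝ} (hφ : ContDiff ℝ 2 φ) (p : 𝔼 × 𝔼) :
    Filter.Tendsto (fun r : ℝ => secondQuotient φ r p) (nhdsWithin 0 (Ioi 0))
      (nhds (fderiv ℝ (fderiv ℝ φ) p.1 p.2 p.2)) := by
  have hD1 : ContDiff ℝ 1 (fderiv ℝ φ) := hφ.fderiv_right (by norm_num)
  have hD2 : Continuous (fderiv ℝ (fderiv ℝ φ)) := hD1.continuous_fderiv (by norm_num)
  have hcont : Continuous fun ξ : ℝ => fderiv ℝ (fderiv ℝ φ) (p.1 + ξ • p.2) p.2 p.2 := by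
    have : Continuous fun ξ : ℝ => fderiv ℝ (fderiv ℝ φ) (p.1 + ξ • p.2) :=
      hD2.comp (by fun_prop)
    exact (this.clm_apply continuous_const).clm_apply continuous_const
  rw [Metric.tendsto_nhds]
  intro ε hε
  have h0 := hcont.tendsto 0
  simp only [zero_smul, add_zero] at h0
  obtain ⟨δ, hδ, hδε⟩ := Metric.tendsto_nhds_nhds.1 h0 ε hε
  filter_upwards [Ioo_mem_nhdsGT hδ] with r hr
  obtain ⟨ξ, hξ, h⟩ := exists_secondQuotient_eq hφ hr.1 p
  rw [h]
  refine hδε ?_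
  rw [Real.dist_eq, sub_zero, abs_of_pos hξ.1]
  exact hξ.2.trans hr.2

/-- Averages over small balls determine the Laplacian: the second order quotients of the ball
means of a test function converge to a multiple of its Laplacian, weakly. -/
theorem tendsto_integral_second_difference (i₀ : Fin n) {φ w : 𝔼 → ℝ} (hφ : ContDiff ℝ 2 φ)
    (hφc : HasCompactSupport φ) (hw : Integrable w) :
    Filter.Tendsto (fun r : ℝ => ∫ x, w x * (2 / r ^ 2 *
        ∫ z in Metric.ball (0 : 𝔼) 1, (φ (x + r • z) - φ x))) (nhdsWithin 0 (Ioi 0))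
      (nhds ((∫ z in Metric.ball (0 : 𝔼) 1, z i₀ * z i₀) *
        ∫ x, w x * Laplacian.laplacian φ x)) := by
  have hD1 : ContDiff ℝ 1 (fderiv ℝ φ) := hφ.fderiv_right (by norm_num)
  have hD2 : Continuous (fderiv ℝ (fderiv ℝ φ)) := hD1.continuous_fderiv (by norm_num)
  obtain ⟨M, hM⟩ := exists_bound_fderiv_fderiv hφ hφc
  have hQb : ∀ r : ℝ, 0 < r → ∀ p : 𝔼 × 𝔼, ‖p.2‖ ≤ 1 → ‖secondQuotient φ r p‖ ≤ M := by
    intro r hr p hp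
    obtain ⟨ξ, -, h⟩ := exists_secondQuotient_eq hφ hr p
    rw [h]
    exact (norm_bilinear_self_le _ hp).trans (hM _)
  have hlim : Filter.Tendsto
      (fun r : ℝ => ∫ p, w p.1 * secondQuotient φ r p
        ∂(volume.prod (volume.restrict (Metric.ball (0 : 𝔼) 1))))
      (nhdsWithin 0 (Ioi 0))
      (nhds (∫ p, w p.1 * fderiv ℝ (fderiv ℝ φ) p.1 p.2 p.2
        ∂(volume.prod (volume.restrict (Metric.ball (0 : 𝔼) 1))))) := by
    refine tendsto_integral_filter_of_dominated_convergence (fun p => |w p.1| * M) ?_ ?_ ?_ ?_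
    · exact Filter.Eventually.of_forall fun r =>
        (hw.aestronglyMeasurable.comp_fst).mul (continuous_secondQuotient hφ r).aestronglyMeasurable
    · filter_upwards [self_mem_nhdsWithin] with r hr
      filter_upwards [ae_snd_mem_unitBall] with p hp
      rw [norm_mul, Real.norm_eq_abs]
      exact mul_le_mul_of_nonneg_left (hQb r hr p hp) (abs_nonneg _)
    · exact (hw.abs.mul_const M).comp_fst _
    · filter_upwards with p
      exact (tendsto_secondQuotient hφ p).const_mul _
  have hintQ : ∀ r : ℝ, 0 < r → Integrable (fun p => w p.1 * secondQuotient φ r p)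
      (volume.prod (volume.restrict (Metric.ball (0 : 𝔼) 1))) := fun r hr =>
    integrable_mul_of_bound hw (continuous_secondQuotient hφ r) (hQb r hr)
  have hintL : Integrable (fun p => w p.1 * fderiv ℝ (fderiv ℝ φ) p.1 p.2 p.2)
      (volume.prod (volume.restrict (Metric.ball (0 : 𝔼) 1))) :=
    integrable_mul_of_bound hw
      (((hD2.comp continuous_fst).clm_apply continuous_snd).clm_apply continuous_snd)
      fun p hp => (norm_bilinear_self_le _ hp).trans (hM _)
  rw [integral_prod _ hintL] at hlim
  have hval : ∫ x, ∫ z in Metric.ball (0 : 𝔼) 1, w x * fderiv ℝ (fderiv ℝ φ) x z z =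
      (∫ z in Metric.ball (0 : 𝔼) 1, z i₀ * z i₀) * ∫ x, w x * Laplacian.laplacian φ x := by
    rw [← integral_const_mul]
    refine integral_congr_ae (Filter.Eventually.of_forall fun x => ?_)
    simp only
    rw [integral_const_mul, setIntegral_unitBall_bilinear _ i₀, laplacian_eq_sum_fderiv]
    ring
  rw [hval] at hlim
  refine hlim.congr' ?_
  filter_upwards [self_mem_nhdsWithin] with r hr
  rw [integral_prod _ (hintQ r hr)]
  refine integral_congr_ae (Filter.Eventually.of_forall fun x => ?_)
  simp only [secondQuotient]
  -- The gradient term, subtracted to keep the quotient bounded as `r → 0`, is odd in `z` and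
  -- integrates to zero.
  rw [integral_const_mul, integral_const_mul, integral_sub, integral_const_mul,
    setIntegral_unitBall_linear, mul_zero, sub_zero]
  · have := hφ.continuous
    exact integrableOn_unitBall (by fun_prop)
  · exact integrableOn_unitBall (by fun_prop)

end

/-! ### Positivity of the distributional Laplacian. -/

section

variable {n : ℕ}

local notation "𝔼" => EuclideanSpace ℝ (Fin n)

/-- Integration over balls of fixed radius has the symmetric kernel `dist x y < r`, so Fubini makes
it self-adjoint. -/
theorem integral_mul_setIntegral_ball_comm {w φ : 𝔼 → ℝ} (hw : Integrable w) (hφ : Integrable φ)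
    (r : ℝ) : Integrable (fun x => w x * ∫ y in Metric.ball x r, φ y) ∧
      Integrable (fun y => φ y * ∫ x in Metric.ball y r, w x) ∧
      ∫ x, w x * ∫ y in Metric.ball x r, φ y = ∫ y, φ y * ∫ x in Metric.ball y r, w x := by
  set S : Set (𝔼 × 𝔼) := {p | dist p.1 p.2 < r} with hS
  have hSm : MeasurableSet S := (isOpen_lt continuous_dist continuous_const).measurableSet
  have hF : Integrable (S.indicator fun p : 𝔼 × 𝔼 => w p.1 * φ p.2) (volume.prod volume) :=
    (hw.mul_prod hφ).indicator hSm
  have e1 : ∀ x, ∫ y, S.indicator (fun p : 𝔼 × 𝔼 => w p.1 * φ p.2) (x, y) =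
      w x * ∫ y in Metric.ball x r, φ y := by
    intro x
    rw [← integral_indicator measurableSet_ball, ← integral_const_mul]
    refine integral_congr_ae (Filter.Eventually.of_forall fun y => ?_)
    by_cases h : dist x y < r
    · have h' : y ∈ Metric.ball x r := Metric.mem_ball'.2 h
      simp [hS, indicator, h, h']
    · have h' : y ∉ Metric.ball x r := fun hh => h (Metric.mem_ball'.1 hh)
      simp [hS, indicator, h, dist_comm y x]
  have e2 : ∀ y, ∫ x, S.indicator (fun p : 𝔼 × 𝔼 => w p.1 * φ p.2) (x, y) =
      φ y * ∫ x in Metric.ball y r, w x := by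
    intro y
    rw [← integral_indicator measurableSet_ball, ← integral_const_mul]
    refine integral_congr_ae (Filter.Eventually.of_forall fun x => ?_)
    by_cases h : dist x y < r
    · simp [hS, indicator, h, mul_comm]
    · simp [hS, indicator, h]
  refine ⟨?_, ?_, ?_⟩
  · simpa only [e1] using hF.integral_prod_left
  · simpa only [e2] using hF.integral_prod_right
  · have := integral_integral_swap (f := fun x y =>
      S.indicator (fun p : 𝔼 × 𝔼 => w p.1 * φ p.2) (x, y)) hF
    simpa only [e1, e2] using this

theorem IsSubharmonicOn.volume_mul_le_setIntegral_ball {u : 𝔼 → EReal} {Ω : Set 𝔼}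
    (hu : IsSubharmonicOn u Ω) (hΩ : IsOpen Ω) (hΩc : IsConnected Ω) {x : 𝔼} {r : ℝ} (hr : 0 < r)
    (hx : Metric.closedBall x r ⊆ Ω) (hxu : u x ≠ ⊥) :
    volume.real (Metric.ball (0 : 𝔼) r) * (u x).toReal ≤ ∫ y in Metric.ball x r, (u y).toReal := by
  have hxΩ := hx (Metric.mem_closedBall_self hr.le)
  have h := hu.le_average x hxΩ r hr hx
  rw [hu.ballAverage_eq_coe hΩ hΩc hr hx, ← EReal.coe_toReal (hu.lt_top x hxΩ).ne hxu,
    EReal.coe_le_coe_iff, ballNormalizer_eq hr 0] at h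
  have hpos : 0 < volume.real (Metric.ball (0 : 𝔼) r) := by
    have := ballNormalizer_pos (n := n) hr
    rwa [ballNormalizer_eq hr 0, inv_pos] at this
  calc _ ≤ volume.real (Metric.ball (0 : 𝔼) r) * ((volume.real (Metric.ball (0 : 𝔼) r))⁻¹ *
        ∫ y in Metric.ball x r, (u y).toReal) := by gcongr
    _ = _ := by rw [mul_inv_cancel_left₀ hpos.ne']

theorem laplacian_eq_zero_of_notMem_tsupport {φ : 𝔼 → ℝ} {x : 𝔼} (hx : x ∉ tsupport φ) :
    Laplacian.laplacian φ x = 0 := by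
  have h : φ =ᶠ[nhds x] fun _ => 0 := notMem_tsupport_iff_eventuallyEq.1 hx
  rw [InnerProductSpace.laplacian_congr_nhds h |>.self_of_nhds]
  simp

/-- Up to a positive factor the integral is the limit of `r ^ (-2)` times `∫ u (mean φ - φ)`.
Self-adjointness of the ball mean moves it onto `u`, giving `∫ φ (mean u - u)`, which is nonnegative
by the mean value inequality. -/
theorem IsSubharmonicOn.integral_laplacian_nonneg {u : 𝔼 → EReal} {Ω : Set 𝔼}
    (hu : IsSubharmonicOn u Ω) (hΩ : IsOpen Ω) (hΩc : IsConnected Ω) (hn : 0 < n) {φ : 𝔼 → ℝ}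
    (hφ : ContDiff ℝ 2 φ) (hφc : HasCompactSupport φ) (hφΩ : tsupport φ ⊆ Ω) (hφ0 : ∀ x, 0 ≤ φ x) :
    0 ≤ ∫ x in Ω, (u x).toReal * Laplacian.laplacian φ x := by
  obtain ⟨δ, hδ, hδΩ⟩ := IsCompact.exists_cthickening_subset_open hφc hΩ hφΩ
  set L := Metric.cthickening δ (tsupport φ) with hL
  have hLc : IsCompact L := IsCompact.cthickening hφc
  have hLm : MeasurableSet L := hLc.isClosed.measurableSet
  -- The cutoff makes `u` globally integrable without changing it on balls of radius below `δ`
  -- centred in the support of `φ`.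
  set w := L.indicator fun x => (u x).toReal with hw
  have hwi : Integrable w := (integrable_indicator_iff hLm).2
    ((hu.locallyIntegrableOn hΩ hΩc).integrableOn_compact_subset hδΩ hLc)
  have hφi : Integrable φ := hφ.continuous.integrable_of_hasCompactSupport hφc
  have hsub : tsupport φ ⊆ L := Metric.self_subset_cthickening _
  have e : ∫ x in Ω, (u x).toReal * Laplacian.laplacian φ x =
      ∫ x, w x * Laplacian.laplacian φ x := by
    rw [← integral_indicator hΩ.measurableSet]
    refine integral_congr_ae (Filter.Eventually.of_forall fun x => ?_)
    by_cases hx : x ∈ tsupport φ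
    · simp [hw, hsub hx, hφΩ hx]
    · simp [laplacian_eq_zero_of_notMem_tsupport hx, indicator]
  rw [e]
  have hlim := tendsto_integral_second_difference ⟨0, hn⟩ hφ hφc hwi
  suffices h : ∀ r, 0 < r → r < δ → 0 ≤ ∫ x, w x * (2 / r ^ 2 *
      ∫ z in Metric.ball (0 : 𝔼) 1, (φ (x + r • z) - φ x)) by
    have h0 := ge_of_tendsto hlim (Filter.mem_of_superset (Ioo_mem_nhdsGT hδ)
      fun r hr => h r hr.1 hr.2)
    exact nonneg_of_mul_nonneg_right h0 (setIntegral_unitBall_sq_pos _)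
  intro r hr hrδ
  set V := volume.real (Metric.ball (0 : 𝔼) r) with hV
  obtain ⟨i1, i2, hswap⟩ := integral_mul_setIntegral_ball_comm hwi hφi r
  have hV' : ∀ x : 𝔼, ∫ y in Metric.ball x r, φ x = V * φ x := fun x => by
    rw [setIntegral_const, smul_eq_mul, hV, measureReal_def, measureReal_def,
      Measure.addHaar_ball_center]
  have e2 : ∀ x, w x * (2 / r ^ 2 * ∫ z in Metric.ball (0 : 𝔼) 1, (φ (x + r • z) - φ x)) =
      2 / r ^ 2 * (r ^ n)⁻¹ * (w x * (∫ y in Metric.ball x r, φ y) - V * (φ x * w x)) := by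
    intro x
    have h1 := setIntegral_ball_eq_unitBall (fun y => φ y - φ x) x hr
    have h3 : ∫ z in Metric.ball (0 : 𝔼) 1, (φ (x + r • z) - φ x) =
        (r ^ n)⁻¹ * ((∫ y in Metric.ball x r, φ y) - V * φ x) := by
      rw [← hV', ← integral_sub hφi.integrableOn (integrableOn_const measure_ball_lt_top.ne), h1,
        inv_mul_cancel_left₀ (pow_pos hr n).ne']
    rw [h3]
    ring
  have hφw : Integrable fun x => φ x * w x := by
    obtain ⟨M, hM⟩ := hφ.continuous.bounded_above_of_compact_support hφc
    exact hwi.bdd_mul hφ.continuous.aestronglyMeasurable (Filter.Eventually.of_forall hM)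
  simp only [e2]
  rw [integral_const_mul, integral_sub i1 (hφw.const_mul V), hswap,
    ← integral_sub i2 (hφw.const_mul V)]
  refine mul_nonneg (by positivity) (integral_nonneg_of_ae ?_)
  filter_upwards [hu.ae_ne_bot hΩ hΩc] with x hx
  by_cases hxs : x ∈ tsupport φ
  · have hball : Metric.closedBall x r ⊆ L :=
      (Metric.closedBall_subset_closedBall hrδ.le).trans
        (Metric.closedBall_subset_cthickening hxs δ)
    have h := hu.volume_mul_le_setIntegral_ball hΩ hΩc hr (hball.trans hδΩ) (hx (hφΩ hxs))
    have h1 : ∫ y in Metric.ball x r, w y = ∫ y in Metric.ball x r, (u y).toReal :=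
      setIntegral_congr_fun measurableSet_ball fun y hy =>
        indicator_of_mem (hball (Metric.ball_subset_closedBall hy)) _
    have h2 : w x = (u x).toReal := indicator_of_mem (hsub hxs) _
    rw [h1, h2]
    have := mul_le_mul_of_nonneg_left h (hφ0 x)
    simp only [Pi.zero_apply]
    linarith
  · simp [image_eq_zero_of_notMem_tsupport hxs]

end

/-! ### Representation of the distributional Laplacian by a Radon measure. -/

section

variable {n : ℕ}

local notation "𝔼" => EuclideanSpace ℝ (Fin n)

/-- The space of test functions on `Ω`. -/
def testFunctions (Ω : Set (EuclideanSpace ℝ (Fin n))) :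
    Submodule ℝ (EuclideanSpace ℝ (Fin n) → ℝ) where
  carrier := {φ | ContDiff ℝ (⊤ : ℕ∞) φ ∧ HasCompactSupport φ ∧ tsupport φ ⊆ Ω}
  add_mem' := by
    rintro φ ψ ⟨h1, h2, h3⟩ ⟨k1, k2, k3⟩
    exact ⟨h1.add k1, h2.add k2, (tsupport_add φ ψ).trans (union_subset h3 k3)⟩
  zero_mem' := ⟨contDiff_const, HasCompactSupport.zero, by simp [tsupport]⟩
  smul_mem' := by
    rintro c φ ⟨h1, h2, h3⟩
    have hsub : tsupport (c • φ) ⊆ tsupport φ := tsupport_smul_subset_right (fun _ => c) φ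
    exact ⟨contDiff_const.smul h1, h2.mono' ((subset_tsupport _).trans hsub), hsub.trans h3⟩

open CompactlySupported in
/-- Restriction of test functions on `Ω` to compactly supported functions on the subtype `Ω`. -/
def testFunctionsRestrict (Ω : Set (EuclideanSpace ℝ (Fin n))) :
    testFunctions Ω →ₗ[ℝ] C_c(Ω, ℝ) where
  toFun φ :=
    { toFun := fun x => φ.1 x
      continuous_toFun := φ.2.1.continuous.comp continuous_subtype_val
      hasCompactSupport' := by
        refine HasCompactSupport.intro (K := Subtype.val ⁻¹' tsupport φ.1) ?_ fun x hx =>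
          image_eq_zero_of_notMem_tsupport hx
        rw [Subtype.isCompact_iff, Subtype.image_preimage_coe, inter_eq_right.2 φ.2.2.2]
        exact φ.2.2.1 }
  map_add' _ _ := rfl
  map_smul' _ _ := rfl

theorem testFunctionsRestrict_injective (Ω : Set 𝔼) :
    Function.Injective (testFunctionsRestrict Ω) := by
  intro φ ψ h
  ext x
  by_cases hx : x ∈ Ω
  · exact DFunLike.congr_fun h ⟨x, hx⟩
  · rw [image_eq_zero_of_notMem_tsupport fun h => hx (φ.2.2.2 h),
      image_eq_zero_of_notMem_tsupport fun h => hx (ψ.2.2.2 h)]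

theorem exists_testFunction_eq_one {Ω : Set 𝔼} (hΩ : IsOpen Ω) {L : Set 𝔼} (hL : IsCompact L)
    (hLΩ : L ⊆ Ω) : ∃ χ ∈ testFunctions Ω, (∀ x, 0 ≤ χ x) ∧ ∀ x ∈ L, χ x = 1 := by
  obtain ⟨V, hV, hLV, hVΩ, hVc⟩ := exists_open_between_and_isCompact_closure hL hΩ hLΩ
  obtain ⟨χ, h1, h2, h3, h4⟩ := exists_contMDiff_support_eq_eq_one_iff
    (modelWithCornersSelf ℝ 𝔼) (n := ⊤) hV hL.isClosed hLV
  have hts : tsupport χ = closure V := by rw [tsupport, h3]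
  exact ⟨χ, ⟨h1.contDiff, by rwa [HasCompactSupport, hts], by rwa [hts]⟩,
    fun x => (h2 (mem_range_self x)).1, fun x hx => (h4 x).1 hx⟩

/-- A positive functional on the test functions on an open set is represented by a Radon
measure. -/
theorem exists_measure_of_nonneg_functional {Ω : Set 𝔼} (hΩ : IsOpen Ω)
    (T : testFunctions Ω →ₗ[ℝ] ℝ) (hT : ∀ φ : testFunctions Ω, (∀ x, 0 ≤ φ.1 x) → 0 ≤ T φ) :
    ∃ ν : Measure 𝔼, IsRadonOn ν Ω ∧ ν Ωᶜ = 0 ∧ ∀ φ : testFunctions Ω, ∫ x, φ.1 x ∂ν = T φ := by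
  have : LocallyCompactSpace Ω := hΩ.locallyCompactSpace
  have : PosSMulMono ℝ (CompactlySupportedContinuousMap Ω ℝ) :=
    ⟨fun a ha _ _ h x => mul_le_mul_of_nonneg_left (h x) ha⟩
  set e := LinearEquiv.ofInjective _ (testFunctionsRestrict_injective Ω) with he
  -- M. Riesz extension for the cone of nonnegative functions carries `T` from test functions to a
  -- positive functional on all of `C_c(Ω)`, without any density argument.
  obtain ⟨g, hg1, hg2⟩ := riesz_extension
    (PointedCone.positive ℝ (CompactlySupportedContinuousMap Ω ℝ))
    ⟨LinearMap.range (testFunctionsRestrict Ω), T ∘ₗ e.symm.toLinearMap⟩ (by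
      rintro ⟨f, φ, rfl⟩ hx
      have h1 : e.symm ⟨testFunctionsRestrict Ω φ, φ, rfl⟩ = φ :=
        (LinearEquiv.symm_apply_eq e).2 rfl
      change 0 ≤ T (e.symm ⟨testFunctionsRestrict Ω φ, φ, rfl⟩)
      rw [h1]
      refine hT φ fun x => ?_
      by_cases hxΩ : x ∈ Ω
      · exact hx ⟨x, hxΩ⟩
      · rw [image_eq_zero_of_notMem_tsupport fun h => hxΩ (φ.2.2.2 h)]) (by
      -- The cofinality condition: a bound for `|y|` times a cutoff equal to one on the support of
      -- `y` is a test function dominating `-y`.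
      intro y
      obtain ⟨M, hM⟩ := y.continuous.bounded_above_of_compact_support y.hasCompactSupport
      obtain ⟨χ, hχ, hχ0, hχ1⟩ := exists_testFunction_eq_one hΩ
        (y.hasCompactSupport.isCompact.image continuous_subtype_val)
        (by rintro _ ⟨z, -, rfl⟩; exact z.2)
      refine ⟨⟨_, M • ⟨χ, hχ⟩, rfl⟩, fun x => ?_⟩
      change 0 ≤ M * χ x + y x
      by_cases hx : x ∈ tsupport y
      · rw [hχ1 x ⟨x, hx, rfl⟩, mul_one]
        linarith [neg_abs_le (y x), (Real.norm_eq_abs (y x)).symm.le.trans (hM x)]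
      · rw [image_eq_zero_of_notMem_tsupport hx, add_zero]
        exact mul_nonneg ((norm_nonneg _).trans (hM x)) (hχ0 _))
  set Λ := PositiveLinearMap.mk₀ g hg2 with hΛ
  refine ⟨(RealRMK.rieszMeasure Λ).map Subtype.val, ?_, ?_, ?_⟩
  · intro L hL hLΩ
    rw [(MeasurableEmbedding.subtype_coe hΩ.measurableSet).map_apply]
    refine IsCompact.measure_lt_top ?_
    rwa [Subtype.isCompact_iff, Subtype.image_preimage_coe, inter_eq_right.2 hLΩ]
  · rw [(MeasurableEmbedding.subtype_coe hΩ.measurableSet).map_apply]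
    simp
  · intro φ
    rw [(MeasurableEmbedding.subtype_coe hΩ.measurableSet).integral_map]
    have h2 := RealRMK.integral_rieszMeasure Λ (testFunctionsRestrict Ω φ)
    have h3 := hg1 ⟨testFunctionsRestrict Ω φ, φ, rfl⟩
    have h1 : e.symm ⟨testFunctionsRestrict Ω φ, φ, rfl⟩ = φ :=
        (LinearEquiv.symm_apply_eq e).2 rfl
    change g (testFunctionsRestrict Ω φ) = T (e.symm ⟨testFunctionsRestrict Ω φ, φ, rfl⟩) at h3
    rw [h1] at h3
    rw [← h3]
    exact h2

theorem continuous_laplacian {φ : 𝔼 → ℝ} (hφ : ContDiff ℝ 2 φ) :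
    Continuous (Laplacian.laplacian φ) := by
  have hD1 : ContDiff ℝ 1 (fderiv ℝ φ) := hφ.fderiv_right (by norm_num)
  have hD2 : Continuous (fderiv ℝ (fderiv ℝ φ)) := hD1.continuous_fderiv (by norm_num)
  rw [funext (laplacian_eq_sum_fderiv φ)]
  exact continuous_finsetSum _ fun i _ =>
    (hD2.clm_apply continuous_const).clm_apply continuous_const

theorem integrableOn_mul_laplacian {v φ : 𝔼 → ℝ} {Ω : Set 𝔼} (hΩ : IsOpen Ω)
    (hv : LocallyIntegrableOn v Ω) (hφ : ContDiff ℝ 2 φ) (hφc : HasCompactSupport φ)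
    (hφΩ : tsupport φ ⊆ Ω) : IntegrableOn (fun x => v x * Laplacian.laplacian φ x) Ω := by
  have h1 : IntegrableOn (fun x => v x * Laplacian.laplacian φ x) (tsupport φ) :=
    (hv.integrableOn_compact_subset hφΩ hφc).mul_continuousOn
      (continuous_laplacian hφ).continuousOn hφc
  refine h1.of_forall_sdiff_eq_zero hΩ.measurableSet fun x hx => ?_
  rw [laplacian_eq_zero_of_notMem_tsupport hx.2, mul_zero]

theorem IsSubharmonicOn.exists_isLaplacianMeasure {u : 𝔼 → EReal} {Ω : Set 𝔼}
    (hu : IsSubharmonicOn u Ω) (hΩ : IsOpen Ω) (hΩc : IsConnected Ω) (hn : 0 < n) :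
    ∃ ν, IsLaplacianMeasure u Ω ν := by
  have h2 : ∀ φ : testFunctions Ω, ContDiff ℝ 2 φ.1 := fun φ =>
    φ.2.1.of_le (by norm_cast)
  have hint : ∀ φ : testFunctions Ω,
      IntegrableOn (fun x => (u x).toReal * Laplacian.laplacian φ.1 x) Ω := fun φ =>
    integrableOn_mul_laplacian hΩ (hu.locallyIntegrableOn hΩ hΩc) (h2 φ) φ.2.2.1 φ.2.2.2
  obtain ⟨ν, h1, h2, h3⟩ := exists_measure_of_nonneg_functional hΩ
    { toFun := fun φ => ∫ x in Ω, (u x).toReal * Laplacian.laplacian φ.1 x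
      map_add' := fun φ ψ => by
        rw [← integral_add (hint φ) (hint ψ)]
        refine integral_congr_ae (Filter.Eventually.of_forall fun x => ?_)
        have := (h2 φ).contDiffAt.laplacian_add (x := x) (h2 ψ).contDiffAt
        simp only [Submodule.coe_add, this, mul_add]
      map_smul' := fun c φ => by
        simp only [RingHom.id_apply, smul_eq_mul]
        rw [← integral_const_mul]
        refine integral_congr_ae (Filter.Eventually.of_forall fun x => ?_)
        have := InnerProductSpace.laplacian_smul (x := x) c (h2 φ).contDiffAt
        simp only [Submodule.coe_smul, this, smul_eq_mul]
        ring }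
    fun φ hφ => hu.integral_laplacian_nonneg hΩ hΩc hn (h2 φ) φ.2.2.1 φ.2.2.2 hφ
  exact ⟨ν, h1, h2, fun φ k1 k2 k3 => h3 ⟨φ, k1, k2, k3⟩⟩

theorem IsSubharmonicOn.isLaplacianMeasure_laplacianMeasure {u : 𝔼 → EReal} {Ω : Set 𝔼}
    (hu : IsSubharmonicOn u Ω) (hΩ : IsOpen Ω) (hΩc : IsConnected Ω) (hn : 0 < n) :
    IsLaplacianMeasure u Ω (laplacianMeasure u Ω) := by
  have h := hu.exists_isLaplacianMeasure hΩ hΩc hn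
  rw [laplacianMeasure, dif_pos h]
  exact h.choose_spec

end

/-! ### Smoothed radial profiles, their densities and potentials. -/

theorem deriv_smoothTransition_eq_zero {t : ℝ} (ht : t ∉ Ioo (0 : ℝ) 1) :
    deriv Real.smoothTransition t = 0 := by
  rcases le_or_gt t 0 with h | h
  · refine IsLocalMin.deriv_eq_zero (Filter.Eventually.of_forall fun s => ?_)
    rw [Real.smoothTransition.zero_of_nonpos h]
    exact Real.smoothTransition.nonneg s
  · have h1 : 1 ≤ t := not_lt.1 fun h1 => ht ⟨h, h1⟩
    refine IsLocalMax.deriv_eq_zero (Filter.Eventually.of_forall fun s => ?_)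
    rw [Real.smoothTransition.one_of_one_le h1]
    exact Real.smoothTransition.le_one s

theorem exists_bound_deriv_smoothTransition :
    ∃ S, 0 ≤ S ∧ ∀ t, |deriv Real.smoothTransition t| ≤ S := by
  have hc : Continuous (deriv Real.smoothTransition) :=
    (Real.smoothTransition.contDiff (n := 1)).continuous_deriv le_rfl
  obtain ⟨S, hS⟩ := (isCompact_Icc (a := (0 : ℝ)) (b := 1)).exists_bound_of_continuousOn
    hc.continuousOn
  refine ⟨S, (norm_nonneg _).trans (hS 0 (by simp)), fun t => ?_⟩
  by_cases ht : t ∈ Ioo (0 : ℝ) 1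
  · exact hS t (Ioo_subset_Icc_self ht)
  · rw [deriv_smoothTransition_eq_zero ht, abs_zero]
    exact (norm_nonneg _).trans (hS 0 (by simp))

/-- A smooth step from `0` to `1` on the interval `[b - η, b]`. -/
noncomputable def smoothStep (b η s : ℝ) : ℝ := Real.smoothTransition ((s - b) / η + 1)

/-- The derivative of `smoothStep`. -/
noncomputable def smoothStepDeriv (b η s : ℝ) : ℝ :=
  deriv Real.smoothTransition ((s - b) / η + 1) / η

theorem hasDerivAt_smoothStep (b η s : ℝ) :
    HasDerivAt (smoothStep b η) (smoothStepDeriv b η s) s := by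
  have h1 : HasDerivAt (fun s : ℝ => (s - b) / η + 1) (1 / η) s :=
    (((hasDerivAt_id s).sub_const b).div_const η).add_const 1
  have h2 := (((Real.smoothTransition.contDiff (n := 1)).differentiable
    (by norm_num)) ((s - b) / η + 1)).hasDerivAt
  have := h2.comp s h1
  rwa [mul_one_div] at this

theorem contDiff_smoothStep (b η : ℝ) : ContDiff ℝ (⊤ : ℕ∞) (smoothStep b η) :=
  Real.smoothTransition.contDiff.comp (by fun_prop)

theorem smoothStep_of_le {b η s : ℝ} (hη : 0 < η) (hs : s ≤ b - η) : smoothStep b η s = 0 := by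
  refine Real.smoothTransition.zero_of_nonpos ?_
  have : (s - b) / η ≤ -1 := by rw [div_le_iff₀ hη]; linarith
  linarith

theorem smoothStep_of_ge {b η s : ℝ} (hη : 0 < η) (hs : b ≤ s) : smoothStep b η s = 1 := by
  refine Real.smoothTransition.one_of_one_le ?_
  have : 0 ≤ (s - b) / η := div_nonneg (by linarith) hη.le
  linarith

theorem smoothStepDeriv_of_le {b η s : ℝ} (hη : 0 < η) (hs : s ≤ b - η) :
    smoothStepDeriv b η s = 0 := by
  have : (s - b) / η ≤ -1 := by rw [div_le_iff₀ hη]; linarith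
  rw [smoothStepDeriv, deriv_smoothTransition_eq_zero fun h => by linarith [h.1], zero_div]

theorem smoothStepDeriv_of_ge {b η s : ℝ} (hη : 0 < η) (hs : b ≤ s) :
    smoothStepDeriv b η s = 0 := by
  have : 0 ≤ (s - b) / η := div_nonneg (by linarith) hη.le
  rw [smoothStepDeriv, deriv_smoothTransition_eq_zero fun h => by linarith [h.2], zero_div]

theorem smoothStep_mem (b η s : ℝ) : 0 ≤ smoothStep b η s ∧ smoothStep b η s ≤ 1 :=
  ⟨Real.smoothTransition.nonneg _, Real.smoothTransition.le_one _⟩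

/-- A smooth approximation of `s ↦ min (b ^ (-m)) (s ^ (-m))`. -/
noncomputable def radialProfile (m b η s : ℝ) : ℝ :=
  b ^ (-m) * (1 - smoothStep b η s) + s ^ (-m) * smoothStep b η s

/-- The value `4 s P' + 4 m P` of the radial Laplacian for the profile `P` given by
`radialProfile`. -/
noncomputable def radialDensity (m b η s : ℝ) : ℝ :=
  4 * m * b ^ (-m) * (1 - smoothStep b η s) +
    4 * s * smoothStepDeriv b η s * (s ^ (-m) - b ^ (-m))

/-- The singularity of `s ^ (-m)` does no harm: the profile is constant for `s ≤ b - η`, a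
neighbourhood of all `s ≤ 0`. -/
theorem contDiff_radialProfile (m : ℝ) {b η : ℝ} (hη : 0 < η) (hb : η < b) :
    ContDiff ℝ (⊤ : ℕ∞) (radialProfile m b η) := by
  rw [contDiff_iff_contDiffAt]
  intro s
  by_cases hs : 0 < s
  · exact (contDiffAt_const.mul (contDiffAt_const.sub (contDiff_smoothStep b η).contDiffAt)).add
      ((Real.contDiffAt_rpow_const_of_ne hs.ne').mul (contDiff_smoothStep b η).contDiffAt)
  · have : radialProfile m b η =ᶠ[nhds s] fun _ => b ^ (-m) := by
      filter_upwards [Iio_mem_nhds (show s < b - η by linarith)] with t ht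
      rw [radialProfile, smoothStep_of_le hη (le_of_lt ht)]
      ring
    exact contDiffAt_const.congr_of_eventuallyEq this

/-- The operator `4 s P' + 4 m P` annihilates `s ^ (-m)` and multiplies constants by `4 m`; the
remaining term comes from differentiating the step. -/
theorem deriv_radialProfile (m : ℝ) {b η : ℝ} (hη : 0 < η) (hb : η < b) (s : ℝ) :
    4 * s * deriv (radialProfile m b η) s + 4 * m * radialProfile m b η s =
      radialDensity m b η s := by
  by_cases hs : 0 < s
  · have h1 := hasDerivAt_smoothStep b η s
    have h2 := Real.hasDerivAt_rpow_const (x := s) (p := -m) (Or.inl hs.ne')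
    have h3 : HasDerivAt (radialProfile m b η) _ s :=
      ((h1.const_sub 1).const_mul (b ^ (-m))).add (h2.mul h1)
    have h4 : s * s ^ (-m - 1) = s ^ (-m) := by
      rw [Real.rpow_sub hs, Real.rpow_one]; field_simp
    rw [h3.deriv, radialProfile, radialDensity, ← h4]
    ring
  · have : radialProfile m b η =ᶠ[nhds s] fun _ => b ^ (-m) := by
      filter_upwards [Iio_mem_nhds (show s < b - η by linarith)] with t ht
      rw [radialProfile, smoothStep_of_le hη (le_of_lt ht)]
      ring
    rw [this.deriv_eq, deriv_const, this.self_of_nhds, radialDensity,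
      smoothStep_of_le hη (by linarith), smoothStepDeriv_of_le hη (by linarith)]
    ring

theorem radialProfile_of_ge {m b η s : ℝ} (hη : 0 < η) (hs : b ≤ s) :
    radialProfile m b η s = s ^ (-m) := by
  rw [radialProfile, smoothStep_of_ge hη hs]; ring

theorem radialProfile_nonneg {m b η s : ℝ} (hb : 0 ≤ b) (hs : 0 ≤ s) :
    0 ≤ radialProfile m b η s := by
  have h := smoothStep_mem b η s
  have h1 := Real.rpow_nonneg hb (-m)
  have h2 := Real.rpow_nonneg hs (-m)
  exact add_nonneg (mul_nonneg h1 (by linarith)) (mul_nonneg h2 h.1)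

theorem radialProfile_le {m b η s : ℝ} (hm : 0 ≤ m) (hη : 0 < η) (hs : 0 < s) :
    radialProfile m b η s ≤ s ^ (-m) := by
  rcases le_or_gt b s with h | h
  · exact (radialProfile_of_ge hη h).le
  · have h1 : b ^ (-m) ≤ s ^ (-m) :=
      Real.rpow_le_rpow_of_nonpos hs h.le (by linarith)
    have h2 := smoothStep_mem b η s
    rw [radialProfile]
    nlinarith [mul_le_mul_of_nonneg_right h1 (show 0 ≤ 1 - smoothStep b η s by linarith)]

theorem radialDensity_of_ge {m b η s : ℝ} (hη : 0 < η) (hs : b ≤ s) :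
    radialDensity m b η s = 0 := by
  rw [radialDensity, smoothStep_of_ge hη hs, smoothStepDeriv_of_ge hη hs]; ring

theorem radialDensity_of_le {m b η s : ℝ} (hη : 0 < η) (hs : s ≤ b - η) :
    radialDensity m b η s = 4 * m * b ^ (-m) := by
  rw [radialDensity, smoothStep_of_le hη hs, smoothStepDeriv_of_le hη hs]; ring

theorem abs_rpow_neg_sub_le {m b s : ℝ} (hm : 0 ≤ m) (hb : 0 < b) (hs : s ∈ Icc (b / 2) b) :
    |s ^ (-m) - b ^ (-m)| ≤ m * (b / 2) ^ (-m - 1) * (b - s) := by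
  have h := (convex_Icc (b / 2) b).norm_image_sub_le_of_norm_hasDerivWithin_le
    (f := fun s : ℝ => s ^ (-m)) (f' := fun s => -m * s ^ (-m - 1))
    (C := m * (b / 2) ^ (-m - 1)) (x := b) (y := s)
    (fun t ht => (Real.hasDerivAt_rpow_const
      (Or.inl (by have := ht.1; linarith : (0 : ℝ) < t).ne')).hasDerivWithinAt)
    (fun t ht => by
      have ht0 : 0 < t := by have := ht.1; linarith
      rw [norm_mul, norm_neg, Real.norm_of_nonneg hm,
        Real.norm_of_nonneg (Real.rpow_nonneg ht0.le _)]
      exact mul_le_mul_of_nonneg_left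
        (Real.rpow_le_rpow_of_nonpos (by linarith) ht.1 (by linarith)) hm)
    ⟨by linarith, le_rfl⟩ hs
  rw [Real.norm_eq_abs, Real.norm_eq_abs, abs_sub_comm s b,
    abs_of_nonneg (show 0 ≤ b - s by linarith [hs.2])] at h
  exact h

/-- Uniformity in `η` is what dominated convergence needs. The derivative of the step is of size
`1/η`, but it lives on `[b - η, b]`, where `s ^ (-m) - b ^ (-m)` is of size `η`. The condition `η ≤
b/2` keeps this interval away from zero. -/
theorem exists_bound_radialDensity {m b : ℝ} (hm : 0 ≤ m) (hb : 0 < b) :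
    ∃ M, ∀ η s, 0 < η → η ≤ b / 2 → |radialDensity m b η s| ≤ M := by
  obtain ⟨S, hS0, hS⟩ := exists_bound_deriv_smoothTransition
  have hq : 0 ≤ b ^ (-m) := Real.rpow_nonneg hb.le _
  have hq' : 0 ≤ (b / 2) ^ (-m - 1) := Real.rpow_nonneg (by linarith) _
  refine ⟨4 * m * b ^ (-m) * 1 + 4 * b * S * (m * (b / 2) ^ (-m - 1)), fun η s hη hηb => ?_⟩
  have h1 := smoothStep_mem b η s
  refine (abs_add_le _ _).trans (add_le_add ?_ ?_)
  · rw [abs_mul, abs_of_nonneg (show 0 ≤ 4 * m * b ^ (-m) by positivity),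
      abs_of_nonneg (show 0 ≤ 1 - smoothStep b η s by linarith)]
    exact mul_le_mul_of_nonneg_left (by linarith) (by positivity)
  · by_cases hs : b - η < s ∧ s < b
    · have hsI : s ∈ Icc (b / 2) b := ⟨by linarith, hs.2.le⟩
      have h2 := abs_rpow_neg_sub_le hm hb hsI
      have h3 : |smoothStepDeriv b η s| ≤ S / η := by
        rw [smoothStepDeriv, abs_div, abs_of_pos hη]
        gcongr
        exact hS _
      rw [abs_mul, abs_mul, abs_of_nonneg (show 0 ≤ 4 * s by linarith [hsI.1])]
      calc 4 * s * |smoothStepDeriv b η s| * |s ^ (-m) - b ^ (-m)|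
          ≤ 4 * b * (S / η) * (m * (b / 2) ^ (-m - 1) * η) := by
            gcongr
            · linarith
            · exact h2.trans (mul_le_mul_of_nonneg_left (by linarith) (by positivity))
        _ = 4 * b * S * (m * (b / 2) ^ (-m - 1)) := by field_simp
    · have : smoothStepDeriv b η s = 0 := by
        by_cases h : s ≤ b - η
        · exact smoothStepDeriv_of_le hη h
        · exact smoothStepDeriv_of_ge hη (not_lt.1 fun h' => hs ⟨not_le.1 h, h'⟩)
      rw [this, mul_zero, zero_mul, abs_zero]
      positivity

theorem continuous_radialDensity (m : ℝ) {b η : ℝ} (hη : 0 < η) (hb : η < b) :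
    Continuous (radialDensity m b η) := by
  rw [← funext (deriv_radialProfile m hη hb)]
  have h2 := (contDiff_radialProfile m hη hb).continuous
  have h3 := (contDiff_radialProfile m hη hb).continuous_deriv (by simp)
  fun_prop

theorem tendsto_radialDensity (m b s : ℝ) :
    Filter.Tendsto (fun η => radialDensity m b η s) (nhdsWithin 0 (Ioi 0))
      (nhds (if s < b then 4 * m * b ^ (-m) else 0)) := by
  refine tendsto_const_nhds.congr' ?_
  split_ifs with h
  · filter_upwards [Ioo_mem_nhdsGT (sub_pos.2 h)] with η hη
    exact (radialDensity_of_le hη.1 (by linarith [hη.2])).symm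
  · filter_upwards [self_mem_nhdsWithin] with η hη
    exact (radialDensity_of_ge hη (not_lt.1 h)).symm

/-- The radial potential of the difference of two densities. -/
noncomputable def radialPotential (m b c η s : ℝ) : ℝ :=
  ∫ t in b..s, (radialProfile m b η t - radialProfile m c η t)

section RadialPotential

variable {m b c η : ℝ}

theorem contDiff_radialProfile_sub (hη : 0 < η) (hc : η < c) (hcb : c ≤ b) :
    ContDiff ℝ (⊤ : ℕ∞) fun t => radialProfile m b η t - radialProfile m c η t :=
  (contDiff_radialProfile m hη (hc.trans_le hcb)).sub (contDiff_radialProfile m hη hc)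

theorem hasDerivAt_radialPotential (hη : 0 < η) (hc : η < c) (hcb : c ≤ b) (s : ℝ) :
    HasDerivAt (radialPotential m b c η) (radialProfile m b η s - radialProfile m c η s) s := by
  have hcont := (contDiff_radialProfile_sub (m := m) hη hc hcb).continuous
  exact intervalIntegral.integral_hasDerivAt_right (hcont.intervalIntegrable _ _)
    (hcont.stronglyMeasurableAtFilter _ _) hcont.continuousAt

theorem contDiff_radialPotential (hη : 0 < η) (hc : η < c) (hcb : c ≤ b) :
    ContDiff ℝ (⊤ : ℕ∞) (radialPotential m b c η) := by
  rw [contDiff_infty_iff_deriv]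
  refine ⟨fun s => (hasDerivAt_radialPotential hη hc hcb s).differentiableAt, ?_⟩
  rw [funext fun s => (hasDerivAt_radialPotential (m := m) hη hc hcb s).deriv]
  exact contDiff_radialProfile_sub hη hc hcb

theorem radialPotential_of_ge (hη : 0 < η) (hcb : c ≤ b) {s : ℝ} (hs : b ≤ s) :
    radialPotential m b c η s = 0 := by
  rw [radialPotential, intervalIntegral.integral_of_le hs]
  refine setIntegral_eq_zero_of_forall_eq_zero fun t ht => ?_
  rw [radialProfile_of_ge hη ht.1.le, radialProfile_of_ge hη (hcb.trans ht.1.le), sub_self]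

/-- For `s ≤ b` the potential is the integral over `(s, b]` of the `c`-profile minus the
`b`-profile. Dropping the latter and bounding the former by `t ^ (-m)` gives an estimate free of
both `c` and `η`. -/
theorem ofReal_radialPotential_le (hm : 0 ≤ m) (hη : 0 < η) (hc : η < c) (hcb : c ≤ b) {s : ℝ}
    (hs : 0 ≤ s) : ENNReal.ofReal (radialPotential m b c η s) ≤
      ∫⁻ t in Ioc s b, ENNReal.ofReal (t ^ (-m)) := by
  rcases le_total b s with h | h
  · simp [radialPotential_of_ge (m := m) hη hcb h]
  have hPc := (contDiff_radialProfile m hη hc).continuous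
  have hint : IntegrableOn (radialProfile m c η) (Ioc s b) :=
    (hPc.continuousOn.integrableOn_compact isCompact_Icc).mono_set Ioc_subset_Icc_self
  have hint' : IntegrableOn (fun t => radialProfile m b η t - radialProfile m c η t) (Ioc s b) :=
    ((contDiff_radialProfile_sub hη hc hcb).continuous.continuousOn.integrableOn_compact
      isCompact_Icc).mono_set Ioc_subset_Icc_self
  have h0 : ∀ᵐ t ∂volume.restrict (Ioc s b), 0 ≤ radialProfile m c η t := by
    filter_upwards [ae_restrict_mem measurableSet_Ioc] with t ht
    exact radialProfile_nonneg (hη.trans hc).le (hs.trans ht.1.le)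
  have h1 : radialPotential m b c η s ≤ ∫ t in Ioc s b, radialProfile m c η t := by
    rw [radialPotential, intervalIntegral.integral_symm, intervalIntegral.integral_of_le h,
      ← integral_neg]
    refine setIntegral_mono_on hint'.neg hint measurableSet_Ioc fun t ht => ?_
    have := radialProfile_nonneg (m := m) (η := η) ((hη.trans hc).le.trans hcb) (hs.trans ht.1.le)
    linarith
  refine (ENNReal.ofReal_le_ofReal h1).trans ?_
  rw [ofReal_integral_eq_lintegral_ofReal hint h0]
  exact setLIntegral_mono' measurableSet_Ioc fun t ht =>
    ENNReal.ofReal_le_ofReal (radialProfile_le hm hη (hs.trans_lt ht.1))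

end RadialPotential

/-! ### Radial test functions and the kernel bound for ball averages. -/

section

variable {n : ℕ}

local notation "𝔼" => EuclideanSpace ℝ (Fin n)

/-- Using the squared norm as radial variable keeps everything differentiable at the centre. -/
theorem laplacian_radial {F P P' : ℝ → ℝ} (hF : ∀ s, HasDerivAt F (P s) s)
    (hP : ∀ s, HasDerivAt P (P' s) s) (x y : 𝔼) :
    Laplacian.laplacian (fun z => F (‖z - x‖ ^ 2)) y =
      4 * ‖y - x‖ ^ 2 * P' (‖y - x‖ ^ 2) + 2 * n * P (‖y - x‖ ^ 2) := by
  have hsq : ∀ z : 𝔼, HasFDerivAt (fun z : 𝔼 => ‖z - x‖ ^ 2) (2 • innerSL ℝ (z - x)) z := fun z => by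
    have := (hasStrictFDerivAt_norm_sq (z - x)).hasFDerivAt.comp z ((hasFDerivAt_id z).sub_const x)
    rwa [ContinuousLinearMap.comp_id] at this
  have h1 : ∀ z : 𝔼, HasFDerivAt (fun z => F (‖z - x‖ ^ 2))
      (P (‖z - x‖ ^ 2) • (2 • innerSL ℝ (z - x))) z := fun z =>
    (hF _).comp_hasFDerivAt z (hsq z)
  have e1 : fderiv ℝ (fun z => F (‖z - x‖ ^ 2)) =
      fun z : 𝔼 => P (‖z - x‖ ^ 2) • ((2 : ℕ) • innerSL ℝ (z - x)) := funext fun z => (h1 z).fderiv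
  have hlin : HasFDerivAt (fun z : 𝔼 => (2 : ℕ) • innerSL ℝ (z - x))
      ((2 : ℕ) • (innerSL ℝ : 𝔼 →L[ℝ] 𝔼 →L[ℝ] ℝ)) y :=
    (((innerSL ℝ : 𝔼 →L[ℝ] 𝔼 →L[ℝ] ℝ).hasFDerivAt (x := y - x)).comp y
      ((hasFDerivAt_id y).sub_const x)).const_smul 2
  have h2 := ((hP _).comp_hasFDerivAt y (hsq y)).smul hlin
  rw [laplacian_eq_sum_fderiv, e1]
  have h3 := h2.fderiv
  simp only [Function.comp_def] at h3
  rw [show (fun z : 𝔼 => P (‖z - x‖ ^ 2) • ((2 : ℕ) • innerSL ℝ (z - x))) =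
    ((fun z => P (‖z - x‖ ^ 2)) • fun z : 𝔼 => (2 : ℕ) • innerSL ℝ (z - x)) from rfl, h3]
  have hnorm : ‖y - x‖ ^ 2 = ∑ i, (y i - x i) ^ 2 := by
    rw [EuclideanSpace.norm_sq_eq]; simp
  have hone : ∀ i : Fin n, innerSL ℝ (EuclideanSpace.single i (1 : ℝ))
      (EuclideanSpace.single i (1 : ℝ)) = 1 := fun i => by
    rw [innerSL_apply_apply]
    simp
  simp [EuclideanSpace.inner_single_right]
  simp only [hone]
  rw [Finset.sum_add_distrib, Finset.sum_const, hnorm, Finset.card_univ, Fintype.card_fin,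
    Finset.mul_sum, Finset.sum_mul, nsmul_eq_mul, add_comm]
  congr 1
  · exact Finset.sum_congr rfl fun i _ => by ring
  · ring

end

theorem ofReal_integral_le_lintegral_ofReal {X : Type*} [MeasurableSpace X] (m : Measure X)
    (f : X → ℝ) : ENNReal.ofReal (∫ x, f x ∂m) ≤ ∫⁻ x, ENNReal.ofReal (f x) ∂m := by
  by_cases hf : Integrable f m
  · rw [integral_eq_lintegral_pos_part_sub_lintegral_neg_part hf]
    exact (ENNReal.ofReal_le_ofReal (sub_le_self _ ENNReal.toReal_nonneg)).trans
      ENNReal.ofReal_toReal_le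
  · simp [integral_undef hf]

section

variable {n : ℕ}

local notation "𝔼" => EuclideanSpace ℝ (Fin n)

theorem radialPotential_mem_testFunctions {m b c η δ : ℝ} (hη : 0 < η) (hc : η < c) (hcb : c ≤ b)
    (hδ : 0 ≤ δ) (hb : b = δ ^ 2) {Ω : Set 𝔼} {x : 𝔼} (hx : Metric.closedBall x δ ⊆ Ω) :
    (fun y => radialPotential m b c η (‖y - x‖ ^ 2)) ∈ testFunctions Ω := by
  have hsupp : tsupport (fun y : 𝔼 => radialPotential m b c η (‖y - x‖ ^ 2)) ⊆
      Metric.closedBall x δ := by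
    refine closure_minimal (fun y hy => ?_) Metric.isClosed_closedBall
    by_contra hyx
    rw [mem_closedBall_iff_norm, not_le] at hyx
    refine hy (radialPotential_of_ge hη hcb ?_)
    rw [hb]
    gcongr
  exact ⟨(contDiff_radialPotential hη hc hcb).comp ((contDiff_id.sub contDiff_const).norm_sq ℝ),
    (isCompact_closedBall x δ).of_isClosed_subset (isClosed_tsupport _) hsupp, hsupp.trans hx⟩

theorem laplacian_radialPotential {b c η : ℝ} (hη : 0 < η) (hc : η < c) (hcb : c ≤ b) (x y : 𝔼) :
    Laplacian.laplacian (fun z => radialPotential (n / 2) b c η (‖z - x‖ ^ 2)) y =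
      radialDensity (n / 2) b η (‖y - x‖ ^ 2) - radialDensity (n / 2) c η (‖y - x‖ ^ 2) := by
  have hb := (contDiff_radialProfile (n / 2) hη (hc.trans_le hcb)).differentiable (by simp)
  have hc' := (contDiff_radialProfile (n / 2) hη hc).differentiable (by simp)
  rw [laplacian_radial (hasDerivAt_radialPotential hη hc hcb)
    (fun s => (hb s).hasDerivAt.sub (hc' s).hasDerivAt),
    ← deriv_radialProfile _ hη (hc.trans_le hcb), ← deriv_radialProfile _ hη hc]
  ring

theorem setIntegral_mul_ite_ball {v : 𝔼 → ℝ} {x : 𝔼} {r δ a : ℝ} (hr : 0 < r) (hrδ : r ≤ δ) :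
    ∫ y in Metric.closedBall x δ, v y * (if ‖y - x‖ ^ 2 < r ^ 2 then a else 0) =
      a * ∫ y in Metric.ball x r, v y := by
  rw [← integral_const_mul, ← integral_indicator measurableSet_closedBall,
    ← integral_indicator measurableSet_ball]
  refine integral_congr_ae (Filter.Eventually.of_forall fun y => ?_)
  by_cases hy : y ∈ Metric.ball x r
  · have h1 : ‖y - x‖ ^ 2 < r ^ 2 := by
      rw [mem_ball_iff_norm] at hy
      gcongr
    have h2 : y ∈ Metric.closedBall x δ :=
      Metric.ball_subset_closedBall (Metric.ball_subset_ball hrδ hy)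
    simp [indicator_of_mem hy, indicator_of_mem h2, h1, mul_comm]
  · have h1 : ¬ ‖y - x‖ ^ 2 < r ^ 2 := by
      rw [mem_ball_iff_norm, not_lt] at hy
      rw [not_lt]
      gcongr
    rw [indicator_of_notMem hy]
    simp [indicator, h1]

/-- With `m = n/2` and `b = r ^ 2` the densities converge boundedly to `2n r ^ (-n)` times the
indicator of the ball of radius `r`. -/
theorem tendsto_integral_radialDensity {v : 𝔼 → ℝ} {x : 𝔼} {r δ : ℝ} (hr : 0 < r) (hrδ : r ≤ δ)
    (hv : IntegrableOn v (Metric.closedBall x δ)) :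
    Filter.Tendsto (fun η : ℝ => ∫ y in Metric.closedBall x δ,
        v y * radialDensity (n / 2) (r ^ 2) η (‖y - x‖ ^ 2)) (nhdsWithin 0 (Ioi 0))
      (nhds (2 * n * (r ^ n)⁻¹ * ∫ y in Metric.ball x r, v y)) := by
  have hr2 : 0 < r ^ 2 := by positivity
  obtain ⟨M, hM⟩ := exists_bound_radialDensity (m := n / 2) (by positivity) hr2
  have hq : 4 * ((n : ℝ) / 2) * (r ^ 2) ^ (-((n : ℝ) / 2)) = 2 * n * (r ^ n)⁻¹ := by
    rw [← Real.rpow_natCast r 2, ← Real.rpow_mul hr.le,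
      show ((2 : ℕ) : ℝ) * -((n : ℝ) / 2) = -n by push_cast; ring, Real.rpow_neg hr.le,
      Real.rpow_natCast]
    ring
  rw [← setIntegral_mul_ite_ball hr hrδ]
  refine tendsto_integral_filter_of_dominated_convergence (fun y => |v y| * M) ?_ ?_ ?_ ?_
  · filter_upwards [Ioo_mem_nhdsGT hr2] with η hη
    exact hv.aestronglyMeasurable.mul ((continuous_radialDensity _ hη.1 hη.2).comp
      (by fun_prop : Continuous fun y : 𝔼 => ‖y - x‖ ^ 2)).aestronglyMeasurable
  · filter_upwards [Ioo_mem_nhdsGT (half_pos hr2)] with η hη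
    refine Filter.Eventually.of_forall fun y => ?_
    rw [norm_mul, Real.norm_eq_abs]
    exact mul_le_mul_of_nonneg_left (hM η _ hη.1 hη.2.le) (abs_nonneg _)
  · exact hv.abs.mul_const M
  · refine Filter.Eventually.of_forall fun y => ?_
    have := tendsto_radialDensity (n / 2) (r ^ 2) (‖y - x‖ ^ 2)
    rw [hq] at this
    exact this.const_mul _

/-- The Newtonian kernel `c ∫_{|y-x|²}^{δ²} t^{-n/2} dt`, without its normalization. -/
noncomputable def radialKernel (δ : ℝ) (x y : EuclideanSpace ℝ (Fin n)) : ℝ≥0∞ :=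
  ∫⁻ t in Ioc (‖y - x‖ ^ 2) (δ ^ 2), ENNReal.ofReal (t ^ (-((n : ℝ) / 2)))

/-- The measure is tested against the radial potential with `b = δ ^ 2` and `c = r ^ 2`. The
potential is at most the kernel for every `η`, while its Laplacian tends to the difference of the
two ball densities as `η → 0`. -/
theorem IsLaplacianMeasure.ofReal_average_sub_le {u : 𝔼 → EReal} {Ω : Set 𝔼} {ν : Measure 𝔼}
    (hν : IsLaplacianMeasure u Ω ν) (hΩ : IsOpen Ω)
    (hv : LocallyIntegrableOn (fun y => (u y).toReal) Ω) {x : 𝔼} {r δ : ℝ} (hr : 0 < r)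
    (hrδ : r ≤ δ) (hx : Metric.closedBall x δ ⊆ Ω) :
    ENNReal.ofReal (2 * n * (δ ^ n)⁻¹ * (∫ y in Metric.ball x δ, (u y).toReal) -
      2 * n * (r ^ n)⁻¹ * ∫ y in Metric.ball x r, (u y).toReal) ≤ ∫⁻ y, radialKernel δ x y ∂ν := by
  have hδ := hr.trans_le hrδ
  have hvδ := hv.integrableOn_compact_subset hx (isCompact_closedBall x δ)
  have hlim := (tendsto_integral_radialDensity hδ le_rfl hvδ).sub
    (tendsto_integral_radialDensity hr hrδ hvδ)
  refine le_of_tendsto ((ENNReal.continuous_ofReal.tendsto _).comp hlim) ?_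
  have hr2 : 0 < r ^ 2 := by positivity
  have hrδ2 : r ^ 2 ≤ δ ^ 2 := by gcongr
  filter_upwards [Ioo_mem_nhdsGT hr2] with η hη
  have htest := radialPotential_mem_testFunctions (m := n / 2) hη.1 hη.2 hrδ2 hδ.le rfl hx
  have hφ := hν.integral_eq _ htest.1 htest.2.1 htest.2.2
  have hbound : ENNReal.ofReal (∫ y, radialPotential (n / 2) (δ ^ 2) (r ^ 2) η (‖y - x‖ ^ 2) ∂ν) ≤
      ∫⁻ y, radialKernel δ x y ∂ν :=
    (ofReal_integral_le_lintegral_ofReal _ _).trans (lintegral_mono fun y =>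
      ofReal_radialPotential_le (by positivity) hη.1 hη.2 hrδ2 (by positivity))
  rw [hφ] at hbound
  refine le_trans (le_of_eq (congrArg ENNReal.ofReal ?_)) hbound
  beta_reduce
  have hcont : ∀ a : ℝ, η < a → Continuous fun y : 𝔼 =>
      radialDensity (n / 2) a η (‖y - x‖ ^ 2) := by
    intro a ha
    exact (continuous_radialDensity _ hη.1 ha).comp (by fun_prop)
  rw [← integral_sub
    (hvδ.mul_continuousOn (hcont _ (hη.2.trans_le hrδ2)).continuousOn (isCompact_closedBall x δ))
    (hvδ.mul_continuousOn (hcont _ hη.2).continuousOn (isCompact_closedBall x δ))]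
  simp only [laplacian_radialPotential hη.1 hη.2 hrδ2, ← mul_sub]
  refine (setIntegral_eq_of_subset_of_forall_sdiff_eq_zero hΩ.measurableSet hx fun y hy => ?_).symm
  have h1 : δ ^ 2 ≤ ‖y - x‖ ^ 2 := by
    have := hy.2
    rw [mem_closedBall_iff_norm, not_le] at this
    gcongr
  rw [radialDensity_of_ge hη.1 h1, radialDensity_of_ge hη.1 (hrδ2.trans h1), sub_self, mul_zero]

/-- For each real `a > u x` some small ball average is at most `a`, so the two-radius estimate holds
with `a` in its place; then `a` decreases to `u x`. -/
theorem IsSubharmonicOn.ballAverage_sub_le {u : 𝔼 → EReal} {Ω : Set 𝔼} {ν : Measure 𝔼}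
    (hu : IsSubharmonicOn u Ω) (hΩ : IsOpen Ω) (hΩc : IsConnected Ω)
    (hν : IsLaplacianMeasure u Ω ν) {x : 𝔼} {δ : ℝ} (hδ : 0 < δ)
    (hx : Metric.closedBall x δ ⊆ Ω) :
    ENNReal.ofReal (2 * n * (volume (Metric.ball (0 : 𝔼) 1)).toReal) *
      (ballAverage u δ x - u x).toENNReal ≤ ∫⁻ y, radialKernel δ x y ∂ν := by
  set κ := 2 * n * (volume (Metric.ball (0 : 𝔼) 1)).toReal with hκ
  have hκ0 : 0 ≤ κ := by positivity
  have hxΩ := hx (Metric.mem_closedBall_self hδ.le)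
  have hnorm : ∀ r : ℝ, 2 * n * (r ^ n)⁻¹ = κ * ballNormalizer n r := fun r => by
    have := (volume_unitBall_toReal_pos (n := n)).ne'
    rw [hκ, ballNormalizer, mul_inv]
    field_simp
  have hsub : ∀ I J r : ℝ, 2 * n * (δ ^ n)⁻¹ * I - 2 * n * (r ^ n)⁻¹ * J =
      κ * (ballNormalizer n δ * I - ballNormalizer n r * J) := fun I J r => by
    rw [hnorm, hnorm]
    ring
  rw [hu.ballAverage_eq_coe hΩ hΩc hδ hx]
  set m := ballNormalizer n δ * ∫ y in Metric.ball x δ, (u y).toReal with hm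
  have key : ∀ a : ℝ, u x < a → ENNReal.ofReal κ * ENNReal.ofReal (m - a) ≤
      ∫⁻ y, radialKernel δ x y ∂ν := by
    intro a ha
    obtain ⟨ρ, hρ, hle⟩ := hu.exists_average_le hΩ hΩc hxΩ ha
    have hr : 0 < min (ρ / 2) δ := by positivity
    have h := hle _ hr ((min_le_left _ _).trans_lt (by linarith))
    refine le_trans ?_ (hν.ofReal_average_sub_le hΩ (hu.locallyIntegrableOn hΩ hΩc) hr
      (min_le_right _ _) hx)
    rw [hsub, ENNReal.ofReal_mul hκ0]
    gcongr
  induction hux : u x with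
  | bot =>
    rw [hux] at key
    rw [EReal.coe_sub_bot, EReal.toENNReal_top]
    rcases hκ0.eq_or_lt with h0 | h0
    · simp [← h0]
    · refine le_of_eq_of_le (ENNReal.mul_top (ENNReal.ofReal_pos.2 h0).ne') (top_le_iff.2 ?_)
      -- When `u x = ⊥` every real `a` is allowed, and `a = m - q / κ` turns the left side of `key`
      -- into the arbitrary number `q`.
      refine ENNReal.eq_top_of_forall_nnreal_le fun q => ?_
      refine le_trans (le_of_eq ?_) (key (m - q / κ) (EReal.bot_lt_coe _))
      rw [← ENNReal.ofReal_mul hκ0, sub_sub_cancel, mul_div_cancel₀ _ h0.ne',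
        ENNReal.ofReal_coe_nnreal]
  | top => exact absurd hux (hu.lt_top x hxΩ).ne
  | coe c =>
    rw [hux] at key
    rw [← EReal.coe_sub, EReal.real_coe_toENNReal]
    have hlim : Filter.Tendsto (fun a => ENNReal.ofReal κ * ENNReal.ofReal (m - a))
        (nhdsWithin c (Ioi c)) (nhds (ENNReal.ofReal κ * ENNReal.ofReal (m - c))) := by
      refine ENNReal.Tendsto.const_mul ?_ (Or.inr ENNReal.ofReal_ne_top)
      exact ((ENNReal.continuous_ofReal.comp (continuous_const.sub continuous_id)).tendsto
        c).mono_left nhdsWithin_le_nhds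
    refine le_of_tendsto hlim ?_
    filter_upwards [self_mem_nhdsWithin] with a ha
    exact key a (EReal.coe_lt_coe_iff.2 ha)

end

/-! ### Integration of the kernel against the measure of prescribed growth. -/

section

variable {n : ℕ}

local notation "𝔼" => EuclideanSpace ℝ (Fin n)

/-- The ball about `y` need not lie in `D`, so the growth bound is not directly available. It is
covered by a fixed number of balls of radius `t / 2`; any of these that meets `K` at a point `x`
lies in `B(x,t)`, which is inside `D` because `t ≤ δ`. -/
theorem measure_inter_ball_le_of_cover {K D : Set 𝔼} {μ : Measure 𝔼} {δ : ℝ} {g : ℝ → ℝ≥0∞}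
    (hμ : ∀ (z : 𝔼) (r : ℝ), 0 < r → Metric.ball z r ⊆ D → μ (Metric.ball z r) ≤ g r)
    (hKD : ∀ x ∈ K, Metric.ball x δ ⊆ D) {T : Finset 𝔼}
    (hT : Metric.closedBall (0 : 𝔼) 1 ⊆ ⋃ p ∈ T, Metric.ball p (1 / 2)) {t : ℝ} (ht : 0 < t)
    (htδ : t ≤ δ) (y : 𝔼) : μ (K ∩ Metric.ball y t) ≤ T.card * g t := by
  have hcov : K ∩ Metric.ball y t ⊆ ⋃ p ∈ T, K ∩ Metric.ball (y + t • p) (t / 2) := by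
    rintro x ⟨hxK, hxy⟩
    have h1 : t⁻¹ • (x - y) ∈ Metric.closedBall (0 : 𝔼) 1 := by
      rw [mem_ball_iff_norm] at hxy
      rw [mem_closedBall_zero_iff, norm_smul, norm_inv, Real.norm_of_nonneg ht.le,
        inv_mul_le_iff₀ ht]
      linarith
    obtain ⟨p, hp, hxp⟩ := mem_iUnion₂.1 (hT h1)
    refine mem_iUnion₂.2 ⟨p, hp, hxK, ?_⟩
    rw [mem_ball_iff_norm] at hxp ⊢
    have h2 : x - (y + t • p) = t • (t⁻¹ • (x - y) - p) := by
      rw [smul_sub, smul_inv_smul₀ ht.ne']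
      abel
    rw [h2, norm_smul, Real.norm_of_nonneg ht.le]
    calc t * ‖t⁻¹ • (x - y) - p‖ < t * (1 / 2) := by gcongr
      _ = t / 2 := by ring
  have hone : ∀ p ∈ T, μ (K ∩ Metric.ball (y + t • p) (t / 2)) ≤ g t := by
    intro p _
    rcases (K ∩ Metric.ball (y + t • p) (t / 2)).eq_empty_or_nonempty with h | ⟨x, hxK, hx⟩
    · simp [h]
    · refine le_trans (measure_mono ?_) (hμ x t ht ((Metric.ball_subset_ball htδ).trans (hKD x hxK)))
      rintro w ⟨-, hw⟩
      have := dist_triangle_right w x (y + t • p)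
      rw [Metric.mem_ball] at hx hw ⊢
      linarith
  calc μ (K ∩ Metric.ball y t) ≤ ∑ p ∈ T, μ (K ∩ Metric.ball (y + t • p) (t / 2)) :=
        (measure_mono hcov).trans (measure_biUnion_finset_le _ _)
    _ ≤ ∑ _p ∈ T, g t := Finset.sum_le_sum hone
    _ = T.card * g t := by rw [Finset.sum_const, nsmul_eq_mul]

/-- A domain of integration independent of `x` and `y`, with a jointly measurable integrand,
prepares for Tonelli. -/
theorem radialKernel_eq (δ : ℝ) (x y : 𝔼) : radialKernel δ x y =
    ∫⁻ t in Ioc 0 (δ ^ 2), {p : 𝔼 × 𝔼 × ℝ | ‖p.2.1 - p.1‖ ^ 2 < p.2.2}.indicator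
      (fun p => ENNReal.ofReal (p.2.2 ^ (-((n : ℝ) / 2)))) (x, y, t) := by
  rw [radialKernel, ← lintegral_indicator measurableSet_Ioc,
    ← lintegral_indicator measurableSet_Ioc]
  refine lintegral_congr fun t => ?_
  by_cases h : ‖y - x‖ ^ 2 < t
  · have h0 : 0 < t := lt_of_le_of_lt (by positivity) h
    by_cases h1 : t ≤ δ ^ 2 <;> simp [indicator, h, h0, h1]
  · simp [indicator, h]

theorem measurable_radialKernel_integrand :
    Measurable ({p : 𝔼 × 𝔼 × ℝ | ‖p.2.1 - p.1‖ ^ 2 < p.2.2}.indicator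
      (fun p => ENNReal.ofReal (p.2.2 ^ (-((n : ℝ) / 2))))) := by
  refine Measurable.indicator (by fun_prop) ?_
  exact measurableSet_lt (by fun_prop) (by fun_prop)

theorem lintegral_radialKernel_le {δ : ℝ} {x : 𝔼} {S : Set 𝔼} (hδ : 0 < δ) (hS : MeasurableSet S)
    (hx : Metric.ball x δ ⊆ S) (ν : Measure 𝔼) :
    ∫⁻ y, radialKernel δ x y ∂ν ≤ ∫⁻ y in S, radialKernel δ x y ∂ν := by
  rw [← lintegral_indicator hS]
  refine lintegral_mono fun y => ?_
  by_cases hy : y ∈ S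
  · rw [indicator_of_mem hy]
  · have h : δ ^ 2 ≤ ‖y - x‖ ^ 2 := by
      have : ¬ ‖y - x‖ < δ := fun h => hy (hx (mem_ball_iff_norm.2 h))
      rw [not_lt] at this
      gcongr
    simp [radialKernel, Ioc_eq_empty_of_le h]

theorem lintegral_Ioc_rpow {a b : ℝ} (ha : 0 < a) (hb : 0 ≤ b) :
    ∫⁻ t in Ioc 0 b, ENNReal.ofReal (t ^ (a - 1)) = ENNReal.ofReal (b ^ a / a) := by
  have hi : IntegrableOn (fun t : ℝ => t ^ (a - 1)) (Ioc 0 b) :=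
    (intervalIntegrable_iff_integrableOn_Ioc_of_le hb).1
      (intervalIntegral.intervalIntegrable_rpow' (by linarith))
  rw [← ofReal_integral_eq_lintegral_ofReal hi, ← intervalIntegral.integral_of_le hb,
    integral_rpow (Or.inl (by linarith)), sub_add_cancel, Real.zero_rpow ha.ne', sub_zero]
  filter_upwards [ae_restrict_mem measurableSet_Ioc] with t ht
  exact Real.rpow_nonneg ht.1.le _

/-- The kernel is integrable, uniformly in the pole, against measures with the growth of
dimension `n - 2 + α`. -/
theorem lintegral_lintegral_radialKernel_le {K S D : Set 𝔼} {μ ν : Measure 𝔼} {δ A α : ℝ}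
    (hα : 0 < α) (hA : 0 ≤ A) (hδ : 0 < δ) (hμK : μ K ≠ ⊤) (hνS : ν S ≠ ⊤)
    (hμ : ∀ (z : 𝔼) (r : ℝ), 0 < r → Metric.ball z r ⊆ D →
      μ (Metric.ball z r) ≤ ENNReal.ofReal (A * r ^ ((n : ℝ) - 2 + α)))
    (hKD : ∀ x ∈ K, Metric.ball x δ ⊆ D) {T : Finset 𝔼}
    (hT : Metric.closedBall (0 : 𝔼) 1 ⊆ ⋃ p ∈ T, Metric.ball p (1 / 2)) :
    ∫⁻ x in K, ∫⁻ y in S, radialKernel δ x y ∂ν ∂μ ≤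
      ENNReal.ofReal (T.card * A * (2 / α) * δ ^ α) * ν S := by
  have : IsFiniteMeasure (μ.restrict K) := ⟨by simpa using hμK.lt_top⟩
  have : IsFiniteMeasure (ν.restrict S) := ⟨by simpa using hνS.lt_top⟩
  have hm := measurable_radialKernel_integrand (n := n)
  set f := {p : 𝔼 × 𝔼 × ℝ | ‖p.2.1 - p.1‖ ^ 2 < p.2.2}.indicator
      (fun p => ENNReal.ofReal (p.2.2 ^ (-((n : ℝ) / 2)))) with hf
  have hinner : ∀ y : 𝔼, ∫⁻ x in K, radialKernel δ x y ∂μ ≤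
      ENNReal.ofReal (T.card * A * (2 / α) * δ ^ α) := by
    intro y
    simp only [radialKernel_eq]
    rw [lintegral_lintegral_swap (f := fun x t => f (x, y, t))
      (hm.comp (by fun_prop : Measurable fun p : 𝔼 × ℝ => (p.1, y, p.2))).aemeasurable]
    calc ∫⁻ t in Ioc 0 (δ ^ 2), ∫⁻ x in K, f (x, y, t) ∂μ
        ≤ ∫⁻ t in Ioc 0 (δ ^ 2), ENNReal.ofReal (T.card * A) *
            ENNReal.ofReal (t ^ (α / 2 - 1)) := by
          refine setLIntegral_mono' measurableSet_Ioc fun t ht => ?_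
          have h1 : ∀ x, f (x, y, t) = (Metric.ball y (√t)).indicator
              (fun _ => ENNReal.ofReal (t ^ (-((n : ℝ) / 2)))) x := by
            intro x
            have : ‖y - x‖ ^ 2 < t ↔ x ∈ Metric.ball y (√t) := by
              rw [mem_ball_iff_norm', Real.lt_sqrt (norm_nonneg _)]
            by_cases h : x ∈ Metric.ball y (√t)
            · rw [indicator_of_mem h]
              exact indicator_of_mem (a := (x, y, t)) (this.2 h) _
            · rw [indicator_of_notMem h]
              exact indicator_of_notMem (a := (x, y, t)) (fun h' => h (this.1 h')) _
          have hsq : 0 < √t := Real.sqrt_pos.2 ht.1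
          have h2 := measure_inter_ball_le_of_cover hμ hKD hT hsq
            (Real.sqrt_le_iff.2 ⟨hδ.le, ht.2⟩) y
          rw [lintegral_congr h1, lintegral_indicator_const measurableSet_ball,
            Measure.restrict_apply measurableSet_ball, inter_comm]
          refine (mul_le_mul_right h2 _).trans (le_of_eq ?_)
          -- The exponents add up to `-n/2 + (n - 2 + α)/2 = α/2 - 1 > -1`: this is where `α > 0`
          -- makes the kernel integrable.
          have h3 : (√t) ^ ((n : ℝ) - 2 + α) = t ^ (((n : ℝ) - 2 + α) / 2) := by
            rw [Real.sqrt_eq_rpow, ← Real.rpow_mul ht.1.le]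
            ring_nf
          have h4 : t ^ (-((n : ℝ) / 2)) * t ^ (((n : ℝ) - 2 + α) / 2) = t ^ (α / 2 - 1) := by
            rw [← Real.rpow_add ht.1]
            ring_nf
          have hq := Real.rpow_nonneg ht.1.le (-((n : ℝ) / 2))
          rw [← ENNReal.ofReal_natCast, ← ENNReal.ofReal_mul (by positivity),
            ← ENNReal.ofReal_mul hq, ← ENNReal.ofReal_mul (by positivity), h3, ← h4]
          ring_nf
      _ = ENNReal.ofReal (T.card * A * (2 / α) * δ ^ α) := by
          rw [lintegral_const_mul' _ _ ENNReal.ofReal_ne_top, lintegral_Ioc_rpow (by positivity)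
            (by positivity), ← ENNReal.ofReal_mul (by positivity), ← Real.rpow_natCast δ 2,
            ← Real.rpow_mul hδ.le]
          congr 1
          rw [show ((2 : ℕ) : ℝ) * (α / 2) = α by push_cast; ring]
          field_simp
  have hmk : Measurable fun p : 𝔼 × 𝔼 => radialKernel δ p.1 p.2 := by
    simp only [radialKernel_eq]
    exact Measurable.lintegral_prod_right'
      (f := fun q : (𝔼 × 𝔼) × ℝ => f (q.1.1, q.1.2, q.2)) (hm.comp (by fun_prop))
  rw [lintegral_lintegral_swap hmk.aemeasurable]
  refine (lintegral_mono fun y => hinner y).trans (le_of_eq ?_)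
  rw [lintegral_const, Measure.restrict_apply_univ]

/-- For `0 < s < δ` the antipodal points `x ± s • e` are at distance `2 s`, and both have norm at
most `R`. -/
theorem le_of_ball_subset_closedBall_zero (hn : 0 < n) {x : 𝔼} {δ R : ℝ}
    (h : Metric.ball x δ ⊆ Metric.closedBall 0 R) (hδ : 0 < δ) : δ ≤ R := by
  refine le_of_forall_lt_imp_le_of_dense fun s hs => ?_
  rcases le_or_gt s 0 with h0 | h0
  · have := h (Metric.mem_ball_self hδ)
    rw [mem_closedBall_zero_iff] at this
    exact h0.trans ((norm_nonneg _).trans this)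
  set e : 𝔼 := EuclideanSpace.single ⟨0, hn⟩ 1 with he
  have hne : ‖e‖ = 1 := by simp [he]
  have hse : ‖s • e‖ = s := by rw [norm_smul, hne, mul_one, Real.norm_of_nonneg h0.le]
  have h1 : x + s • e ∈ Metric.closedBall (0 : 𝔼) R := h (by
    rw [mem_ball_iff_norm, add_sub_cancel_left, hse]; exact hs)
  have h2 : x - s • e ∈ Metric.closedBall (0 : 𝔼) R := h (by
    rw [mem_ball_iff_norm, sub_sub_cancel_left, norm_neg, hse]; exact hs)
  rw [mem_closedBall_zero_iff] at h1 h2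
  have h3 := norm_sub_le (x + s • e) (x - s • e)
  rw [add_sub_sub_cancel, ← two_smul ℝ (s • e), norm_smul, hse] at h3
  norm_num at h3
  linarith

end

/-! ### The estimate. -/

theorem theorem4p1 (n : ℕ) (hn : 2 ≤ n) (Ω : Set (EuclideanSpace ℝ (Fin n)))
    (hΩ : IsOpen Ω) (hΩc : IsConnected Ω) (hΩb : Bornology.IsBounded Ω)
    (α A ε : ℝ) (hα : 0 < α) (hA : 0 < A) (hε : 0 < ε)
    (K : Set (EuclideanSpace ℝ (Fin n))) (hK : MeasurableSet K) :
    ∃ C : ℝ, 0 < C ∧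
      ∀ D : Set (EuclideanSpace ℝ (Fin n)), IsOpen D →
        IsCompact (closure D) → closure D ⊆ Ω →
        IsCompact (closure K) → closure K ⊆ D →
      ∀ μ : Measure (EuclideanSpace ℝ (Fin n)), IsRadonOn μ Ω →
        (∀ (z : EuclideanSpace ℝ (Fin n)) (r : ℝ), 0 < r → Metric.ball z r ⊆ D →
          μ (Metric.ball z r) ≤ ENNReal.ofReal (A * r ^ ((n : ℝ) - 2 + α))) →
      ∀ u : EuclideanSpace ℝ (Fin n) → EReal, IsSubharmonicOn u Ω →
      ∀ δ : ℝ, 0 < δ → (∀ x ∈ K, Metric.ball x δ ⊆ D) →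
        (∀ x ∈ K, ballAverage u δ x ≠ ⊥ ∧ ballAverage u δ x ≠ ⊤ ∧ u x ≤ ballAverage u δ x) ∧
        ∫⁻ x in K, (ballAverage u δ x - u x).toENNReal ∂μ ≤
          ENNReal.ofReal C * laplacianMeasure u Ω (closure D) *
            ENNReal.ofReal (δ ^ ((α - ε) / (1 + α))) := by
  have hn0 : 0 < n := by omega
  obtain ⟨R, hR⟩ := hΩb.subset_closedBall 0
  obtain ⟨T', -, hT'f, hT'⟩ :=
    (isCompact_closedBall (0 : EuclideanSpace ℝ (Fin n)) 1).finite_cover_balls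
    (show (0 : ℝ) < 1 / 2 by norm_num)
  set T := hT'f.toFinset with hTdef
  have hT : Metric.closedBall (0 : EuclideanSpace ℝ (Fin n)) 1 ⊆
      ⋃ p ∈ T, Metric.ball p (1 / 2) := by simpa [hTdef] using hT'
  set κ := 2 * n * (volume (Metric.ball (0 : EuclideanSpace ℝ (Fin n)) 1)).toReal with hκ
  have hκ0 : 0 < κ := by
    have := volume_unitBall_toReal_pos (n := n)
    positivity
  set β := (α - ε) / (1 + α) with hβ
  -- The kernel estimate yields `δ ^ α`; the positive surplus `α - β` is absorbed into the constant
  -- through `δ ≤ |R|`.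
  have hβα : 0 < α - β := by
    have : α - β = (α ^ 2 + ε) / (1 + α) := by rw [hβ]; field_simp; ring
    rw [this]
    positivity
  set M := T.card * A * (2 / α) with hM
  have hM0 : 0 ≤ M := by positivity
  -- Here `M` comes from the kernel integral and `κ = 2n c_n` from the normalization of the
  -- averages; the summand `1` only secures strict positivity.
  refine ⟨M / κ * |R| ^ (α - β) + 1, by positivity, ?_⟩
  intro D hD hDc hDΩ hKc hKD μ hμR hμ u hu δ hδ hKδ
  have hball : ∀ x ∈ K, Metric.closedBall x δ ⊆ Ω := fun x hx => by
    rw [← closure_ball x hδ.ne']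
    exact (closure_mono (hKδ x hx)).trans hDΩ
  have hν := hu.isLaplacianMeasure_laplacianMeasure hΩ hΩc hn0
  set ν := laplacianMeasure u Ω with hνdef
  refine ⟨fun x hx => ⟨?_, ?_, ?_⟩, ?_⟩
  · rw [hu.ballAverage_eq_coe hΩ hΩc hδ (hball x hx)]
    exact EReal.coe_ne_bot _
  · rw [hu.ballAverage_eq_coe hΩ hΩc hδ (hball x hx)]
    exact EReal.coe_ne_top _
  · exact hu.le_average x (hball x hx (Metric.mem_closedBall_self hδ.le)) δ hδ (hball x hx)
  -- The bound on `δ` needs a point of `K`; for empty `K` the radius is unrestricted, but the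
  -- integral vanishes.
  · rcases K.eq_empty_or_nonempty with rfl | ⟨x₀, hx₀⟩
    · simp
    have hδR : δ ≤ |R| := (le_of_ball_subset_closedBall_zero hn0
      (Metric.ball_subset_closedBall.trans ((hball x₀ hx₀).trans hR)) hδ).trans (le_abs_self R)
    have hμK : μ K ≠ ⊤ := ne_top_of_le_ne_top
      (hμR _ hKc (hKD.trans (subset_closure.trans hDΩ))).ne (measure_mono subset_closure)
    have hνD : ν (closure D) ≠ ⊤ := (hν.radon _ hDc hDΩ).ne
    have hmain : ENNReal.ofReal κ * ∫⁻ x in K, (ballAverage u δ x - u x).toENNReal ∂μ ≤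
        ENNReal.ofReal (M * δ ^ α) * ν (closure D) := by
      rw [← lintegral_const_mul' _ _ ENNReal.ofReal_ne_top]
      refine le_trans (setLIntegral_mono' hK fun x hx => ?_)
        (lintegral_lintegral_radialKernel_le hα hA.le hδ hμK hνD hμ hKδ hT)
      exact (hu.ballAverage_sub_le hΩ hΩc hν hδ (hball x hx)).trans
        (lintegral_radialKernel_le hδ isClosed_closure.measurableSet
          ((hKδ x hx).trans subset_closure) ν)
    have hκ' : ENNReal.ofReal κ ≠ 0 := (ENNReal.ofReal_pos.2 hκ0).ne'
    rw [← ENNReal.mul_le_mul_iff_right hκ' ENNReal.ofReal_ne_top]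
    refine hmain.trans ?_
    have hreal : M * δ ^ α ≤ κ * ((M / κ * |R| ^ (α - β) + 1) * δ ^ β) := by
      have h1 : δ ^ α = δ ^ (α - β) * δ ^ β := by
        rw [← Real.rpow_add hδ, sub_add_cancel]
      have h2 : δ ^ (α - β) ≤ |R| ^ (α - β) := Real.rpow_le_rpow hδ.le hδR hβα.le
      have h3 : 0 ≤ δ ^ β := Real.rpow_nonneg hδ.le _
      calc M * δ ^ α = M * (δ ^ (α - β) * δ ^ β) := by rw [h1]
        _ ≤ M * (|R| ^ (α - β) * δ ^ β) := by gcongr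
        _ ≤ M * (|R| ^ (α - β) * δ ^ β) + κ * δ ^ β := le_add_of_nonneg_right (by positivity)
        _ = κ * ((M / κ * |R| ^ (α - β) + 1) * δ ^ β) := by field_simp
    calc ENNReal.ofReal (M * δ ^ α) * ν (closure D)
        ≤ ENNReal.ofReal (κ * ((M / κ * |R| ^ (α - β) + 1) * δ ^ β)) * ν (closure D) := by
          gcongr
      _ = _ := by
          have hC : 0 ≤ M / κ * |R| ^ (α - β) + 1 := by positivity
          rw [ENNReal.ofReal_mul hκ0.le, ENNReal.ofReal_mul hC]
          ring
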